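/- Let $(\mathbb P_x)_{x\in\mathbb R}$ be probability measures on a measurable space, with expectations $\mathbb E_x$, and let $Y=(Y(t);t\ge 0)$ be a real-valued time-homogeneous Markov process with càdlàg paths, with $Y(0)=x$ $\mathbb P_x$-almost surely. Let $W_0,W_1,\dots$ be, under every $\mathbb P_x$, i.i.d. exponential random variables with rate $\lambda>0$, independent of $Y$; put $T_0=0$ and $T_n=W_0+\dots+W_{n-1}$. Let $q>0$, let $R:\mathbb R\to\mathbb R$ be strictly increasing, and assume that $$\mathbb E_x\Big[\sum_{s=0}^\infty |R(Y(T_s))|\int_{T_s}^{T_{s+1}}e^{-qr}\,dr\Big]<\infty\qquad\text{for every }x\in\mathbb R.$$ Assume that $Y$ is order-preserving: for all $x<y$ there are, on a common probability space, processes $Y_x$ and $Y_y$ with the laws of $Y$ under $\mathbb P_x$ and $\mathbb P_y$ such that almost surely $Y_x(t)\le Y_y(t)$ for all $t\ge 0$. For $x\in\mathbb R$ define the Gittins index $$\Gamma(x)=\sup_{\tau>0}\frac{\mathbb E_x\big[\sum_{s=0}^{\tau-1}e^{-qT_s}R(Y(T_s))\big]}{\mathbb E_x\big[\sum_{s=0}^{\tau-1}e^{-qT_s}\big]},$$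 the supremum being over all stopping times $\tau$ with values in $\{1,2,\dots\}\cup\{\infty\}$ of the filtration $(\mathcal F_s)_{s\ge 0}$, where $\mathcal F_s$ is the $\mathbb P_x$-completion of $\sigma(Y(T_0),\dots,Y(T_s),W_0,\dots,W_{s-1})$. Let $T_x^-=\inf\{T_n: n\ge 0,\ T_n>0,\ Y(T_n)\le x\}$, with $\inf\emptyset=\infty$. Then, for every $x\in\mathbb R$, the supremum is finite, the random variables $\int_0^{T_x^-}e^{-qs}R(Y(s))1_{\{Y(s)>x\}}\,ds$ and $\int_0^{T_x^-}e^{-qs}1_{\{Y(s)>x\}}\,ds$ are well defined $\mathbb P_x$-almost surely and $\mathbb P_x$-integrable, and $$\Gamma(x)=\frac{R(x)+\lambda\,\mathbb E_x\Big[\int_0^{T_x^-}e^{-qs}R(Y(s))1_{\{Y(s)>x\}}\,ds\Big]}{1+\lambda\,\mathbb E_x\Big[\int_0^{T_x^-}e^{-qs}1_{\{Y(s)>x\}}\,ds\Big]}.$$ -/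

import Mathlib

open MeasureTheory ProbabilityTheory Filter Topology
open scoped NNReal ENNReal

universe u

noncomputable section

/-- A real-valued path on `[0, ∞)` is càdlàg: right-continuous with finite left limits. -/
def IsCadlag (f : ℝ≥0 → ℝ) : Prop :=
  (∀ t, ContinuousWithinAt f (Set.Ici t) t) ∧ ∀ t, ∃ l : ℝ, Tendsto f (𝓝[<] t) (𝓝 l)

/-- `Y` is a time-homogeneous real-valued Markov process with càdlàg paths under the family of
laws `P x` (the process started from `x`), with respect to its natural filtration. -/
structure IsCadlagMarkovProcess {Ω : Type u} [MeasurableSpace Ω]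
    (P : ℝ → Measure Ω) (Y : ℝ≥0 → Ω → ℝ) : Prop where
  isProbabilityMeasure : ∀ x, IsProbabilityMeasure (P x)
  measurable : ∀ t, Measurable (Y t)
  cadlag : ∀ ω, IsCadlag (fun t => Y t ω)
  start : ∀ x, ∀ᵐ ω ∂(P x), Y 0 ω = x
  measurable_transition : ∀ (t : ℝ≥0) (A : Set ℝ), MeasurableSet A →
    Measurable (fun x => P x (Y t ⁻¹' A))
  /-- `P_x(Y(t + s) ∈ A | σ(Y(r), r ≤ t)) = P_{Y(t)}(Y(s) ∈ A)`, `P_x`-almost surely. -/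
  markov : ∀ (x : ℝ) (t s : ℝ≥0) (A : Set ℝ), MeasurableSet A →
    (P x)[(Y (t + s) ⁻¹' A).indicator (fun _ => (1 : ℝ)) |
        ⨆ r ∈ Set.Iic t, MeasurableSpace.comap (Y r) inferInstance]
      =ᵐ[P x] fun ω => (P (Y t ω)).real (Y s ⁻¹' A)

/-- The process is order-preserving: for `x < y`, paths started from `x` and from `y` can be
realised together on one probability space so that, almost surely, the first stays below the
second at all times. -/
def IsOrderPreserving {Ω : Type u} [MeasurableSpace Ω]
    (P : ℝ → Measure Ω) (Y : ℝ≥0 → Ω → ℝ) : Prop :=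
  ∀ x y : ℝ, x < y →
    ∃ (Ω' : Type u) (_ : MeasurableSpace Ω') (Q : Measure Ω') (Yx Yy : ℝ≥0 → Ω' → ℝ),
      IsProbabilityMeasure Q ∧
      IdentDistrib (fun ω t => Yx t ω) (fun ω t => Y t ω) Q (P x) ∧
      IdentDistrib (fun ω t => Yy t ω) (fun ω t => Y t ω) Q (P y) ∧
      ∀ᵐ ω ∂Q, ∀ t, Yx t ω ≤ Yy t ω

/-- Under every `P x`, the durations `W 0, W 1, …` are i.i.d. exponential with rate `l`, and the
sequence is independent of the process `Y`. -/
structure IsExponentialClock {Ω : Type u} [MeasurableSpace Ω]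
    (P : ℝ → Measure Ω) (Y : ℝ≥0 → Ω → ℝ) (W : ℕ → Ω → ℝ≥0) (l : ℝ) : Prop where
  measurable : ∀ n, Measurable (W n)
  law : ∀ x n, (P x).map (fun ω => (W n ω : ℝ)) = expMeasure l
  iIndep : ∀ x, iIndepFun W (P x)
  indep : ∀ x, IndepFun (fun ω t => Y t ω) (fun ω n => W n ω) (P x)

section
variable {Ω : Type u}

/-- The `n`-th observation time `T_n = W_0 + ⋯ + W_{n-1}`, with `T_0 = 0`. -/
def obsTime (W : ℕ → Ω → ℝ≥0) (n : ℕ) (ω : Ω) : ℝ≥0 := ∑ i ∈ Finset.range n, W i ω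

/-- The observed state `Y(T_n)`. -/
def obsState (Y : ℝ≥0 → Ω → ℝ) (W : ℕ → Ω → ℝ≥0) (n : ℕ) (ω : Ω) : ℝ := Y (obsTime W n ω) ω

/-- The completion, under the given measure, of
`σ(Y(T_0), …, Y(T_n), W_0, …, W_{n-1})`. -/
abbrev obsInfo [MeasurableSpace Ω] (μ : Measure Ω) (Y : ℝ≥0 → Ω → ℝ) (W : ℕ → Ω → ℝ≥0) (n : ℕ) :
    MeasurableSpace Ω :=
  eventuallyMeasurableSpace
    ((⨆ i ∈ Finset.range (n + 1), MeasurableSpace.comap (obsState Y W i) inferInstance) ⊔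
      ⨆ i ∈ Finset.range n, MeasurableSpace.comap (W i) inferInstance)
    (ae μ)

/-- Strictly positive, possibly infinite, stopping times of the completed observation
filtration. -/
def IsPositiveStoppingTime [MeasurableSpace Ω] (μ : Measure Ω) (Y : ℝ≥0 → Ω → ℝ)
    (W : ℕ → Ω → ℝ≥0) (τ : Ω → ℕ∞) : Prop :=
  (∀ ω, 0 < τ ω) ∧ ∀ n : ℕ, MeasurableSet[obsInfo μ Y W n] {ω | τ ω ≤ (n : ℕ∞)}

/-- `∑_{s=0}^{τ-1} e^{-q T_s} f(Y(T_s))`. -/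
def discountedSum (q : ℝ) (f : ℝ → ℝ) (Y : ℝ≥0 → Ω → ℝ) (W : ℕ → Ω → ℝ≥0) (τ : Ω → ℕ∞)
    (ω : Ω) : ℝ :=
  ∑' s : ℕ, if (s : ℕ∞) < τ ω then
    Real.exp (-q * (obsTime W s ω : ℝ)) * f (obsState Y W s ω) else 0

/-- The ratios of expected discounted reward to expected discounted number of operations, over
all strictly positive stopping times, for the arm started from `x`. -/
def gittinsRatios [MeasurableSpace Ω] (P : ℝ → Measure Ω) (Y : ℝ≥0 → Ω → ℝ)
    (W : ℕ → Ω → ℝ≥0) (q : ℝ) (R : ℝ → ℝ) (x : ℝ) : Set ℝ :=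
  {v | ∃ τ : Ω → ℕ∞, IsPositiveStoppingTime (P x) Y W τ ∧
    v = (∫ ω, discountedSum q R Y W τ ω ∂(P x)) /
        (∫ ω, discountedSum q (fun _ => 1) Y W τ ω ∂(P x))}

/-- The Gittins index `Γ(x)`. -/
def gittinsIndex [MeasurableSpace Ω] (P : ℝ → Measure Ω) (Y : ℝ≥0 → Ω → ℝ)
    (W : ℕ → Ω → ℝ≥0) (q : ℝ) (R : ℝ → ℝ) (x : ℝ) : ℝ :=
  sSup (gittinsRatios P Y W q R x)

/-- The standing integrability condition
`E_x[∑_s |R(Y(T_s))| ∫_{T_s}^{T_{s+1}} e^{-qr} dr] < ∞` for every starting point `x`. -/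
def HasFiniteDiscountedReward [MeasurableSpace Ω] (P : ℝ → Measure Ω) (Y : ℝ≥0 → Ω → ℝ)
    (W : ℕ → Ω → ℝ≥0) (q : ℝ) (R : ℝ → ℝ) : Prop :=
  ∀ x, ∫⁻ ω, ∑' s : ℕ, ENNReal.ofReal (|R (obsState Y W s ω)| *
    ∫ r in (obsTime W s ω : ℝ)..(obsTime W (s + 1) ω : ℝ), Real.exp (-q * r)) ∂(P x) < ∞

/-- `T_x^-`: the first strictly positive observation time at which the process is at or
below `x` (infinite if there is none). -/
def firstObsBelow (Y : ℝ≥0 → Ω → ℝ) (W : ℕ → Ω → ℝ≥0) (x : ℝ) (ω : Ω) : ℝ≥0∞ :=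
  sInf {T | ∃ n : ℕ, T = (obsTime W n ω : ℝ≥0∞) ∧ 0 < T ∧ obsState Y W n ω ≤ x}

/-- The set of times `0 < s < T_x^-`, as real numbers. -/
def timesBefore (Y : ℝ≥0 → Ω → ℝ) (W : ℕ → Ω → ℝ≥0) (x : ℝ) (ω : Ω) : Set ℝ :=
  {s | 0 < s ∧ ENNReal.ofReal s < firstObsBelow Y W x ω}

/-- `e^{-qs} f(Y(s)) 1_{Y(s) > x}`. -/
def excursionIntegrand (q : ℝ) (f : ℝ → ℝ) (Y : ℝ≥0 → Ω → ℝ) (x : ℝ) (ω : Ω) (s : ℝ) : ℝ :=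
  Real.exp (-q * s) * f (Y s.toNNReal ω) * (if x < Y s.toNNReal ω then 1 else 0)

/-- `∫_0^{T_x^-} e^{-qs} f(Y(s)) 1_{Y(s) > x} ds`. -/
def excursionIntegral (q : ℝ) (f : ℝ → ℝ) (Y : ℝ≥0 → Ω → ℝ) (W : ℕ → Ω → ℝ≥0) (x : ℝ)
    (ω : Ω) : ℝ :=
  ∫ s in timesBefore Y W x ω, excursionIntegrand q f Y x ω s

/-- The random variable `∫_0^{T_x^-} e^{-qs} f(Y(s)) 1_{Y(s) > x} ds` is well defined almost
surely (as an absolutely convergent integral) and integrable. -/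
def HasIntegrableExcursion [MeasurableSpace Ω] (μ : Measure Ω) (q : ℝ) (f : ℝ → ℝ)
    (Y : ℝ≥0 → Ω → ℝ) (W : ℕ → Ω → ℝ≥0) (x : ℝ) : Prop :=
  (∀ᵐ ω ∂μ, IntegrableOn (excursionIntegrand q f Y x ω) (timesBefore Y W x ω)) ∧
    Integrable (excursionIntegral q f Y W x) μ

end

end

/-! Write X_n = Y(T_n) and D_n = e^{-q T_n}. Let τ₀ be the first n ≥ 1 with X_n ≤ x, and let γ be
the ratio it achieves. The claim is that γ is the maximum of all ratios; the formula then evaluates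
γ.

Optimality. With g = R - γ, stopping at τ₀ is a fair game, and it has to be shown that no τ makes E
Σ_{s<τ} D_s g(X_s) positive. Split g = p - m into positive and negative parts, let K be the
discounted kernel of the chain, and let V ≥ 0 be the least solution of V = (p + KV - m)^+. Order
preservation makes K preserve increasing functions, and g is increasing, so V is increasing
(`monotone_stoppingValue`). Suppose V(x) > 0. Then V > 0 on [x, ∞), so there Bellman's equation
holds without truncation and can be iterated up to τ₀. Fairness cancels the sums of p and m, leaving
V(x) ≤ E[D_{τ₀} V(X_{τ₀}); τ₀ < ∞] ≤ V(x) E[D_1] < V(x), because X_{τ₀} ≤ x and τ₀ ≥ 1. Hence V(x) =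
0 (`stoppingValue_eq_zero`). Telescoping p + KV ≤ V + m along an arbitrary τ now bounds its gain by
its loss (`gain_le_value_add_loss`). This part runs in [0, ∞], with gains and losses on opposite
sides, so that nothing has to be subtracted before finiteness is known.

Formula. For an exponential W of rate λ, P(W > u) is the density at u divided by λ. So λ times the
mean discounted time integral over (T_n, T_{n+1}) is the mean discounted value at T_{n+1}
(`lintegral_clockLaw_setLIntegral`). Summed over n < τ₀, the factor 1_{Y > x} turns {n < τ₀} into {n
+ 1 < τ₀}, and the excursion integral becomes the sum of the steps n ≥ 1 before τ₀
(`lintegral_excursion`). Step 0 contributes R(x) to the numerator and 1 to the denominator. -/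

noncomputable section

/-! ### Measurability of paths, independence of the clock, and the transition kernel -/

section Paths

section RightContinuous

variable {α : Type*} [MeasurableSpace α]

/-- Replace t by the next point strictly to its right on the grid of mesh 1/(n+1). The
approximations take countably many times, hence are jointly measurable, and they converge by
right-continuity. -/
lemma measurable_uncurry_of_rightContinuous {u : ℝ≥0 → α → ℝ} (hu : ∀ t, Measurable (u t))
    (hc : ∀ a t, ContinuousWithinAt (fun t => u t a) (Set.Ici t) t) :
    Measurable fun p : α × ℝ≥0 => u p.2 p.1 := by
  let φ : ℕ → ℝ≥0 → ℝ≥0 := fun n t => (⌊((n : ℝ≥0) + 1) * t⌋₊ + 1) / ((n : ℝ≥0) + 1)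
  have hφ : ∀ t, Tendsto (fun n => φ n t) atTop (𝓝[Set.Ici t] t) := by
    intro t
    refine tendsto_nhdsWithin_iff.2 ⟨?_, Eventually.of_forall fun n => ?_⟩
    · have h1 : Tendsto (fun n : ℕ => t + 1 / ((n : ℝ≥0) + 1)) atTop (𝓝 t) := by
        simpa using tendsto_const_nhds.add (tendsto_one_div_add_atTop_nhds_zero_nat (𝕜 := ℝ≥0))
      refine tendsto_of_tendsto_of_tendsto_of_le_of_le tendsto_const_nhds h1 (fun n => ?_)
        fun n => ?_
      · dsimp only [φ]
        rw [le_div_iff₀ (by positivity), mul_comm]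
        exact (Nat.lt_floor_add_one _).le
      · dsimp only [φ]
        have hpos : ((n : ℝ≥0) + 1) ≠ 0 := by positivity
        rw [div_le_iff₀ (by positivity), add_mul t, one_div, inv_mul_cancel₀ hpos, mul_comm t]
        exact add_le_add_left (Nat.floor_le (by positivity)) _
    · dsimp only [φ]
      rw [Set.mem_Ici, le_div_iff₀ (by positivity), mul_comm]
      exact (Nat.lt_floor_add_one _).le
  refine measurable_of_tendsto_metrizable (f := fun n (p : α × ℝ≥0) => u (φ n p.2) p.1)
    (fun n => ?_) ?_
  · have h1 : Measurable fun p : α × ℕ => u ((p.2 + 1) / ((n : ℝ≥0) + 1)) p.1 :=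
      measurable_from_prod_countable_left fun k => hu ((k + 1) / ((n : ℝ≥0) + 1))
    have h2 : Measurable fun p : α × ℝ≥0 => (p.1, ⌊((n : ℝ≥0) + 1) * p.2⌋₊) :=
      measurable_fst.prodMk (Nat.measurable_floor.comp (measurable_snd.const_mul _))
    have h3 := h1.comp h2
    simp only [Function.comp_def] at h3
    exact h3
  · rw [tendsto_pi_nhds]
    intro p
    exact (hc p.1 p.2).tendsto.comp (hφ p.2)

end RightContinuous

section Independence

variable {Ω α β γ : Type*} [mΩ : MeasurableSpace Ω] [MeasurableSpace α] [MeasurableSpace β]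
  [MeasurableSpace γ] {μ : Measure Ω} [IsProbabilityMeasure μ]

lemma lintegral_comp_of_indepFun {X : Ω → α} {U : Ω → β} (hX : Measurable X) (hU : Measurable U)
    (h : IndepFun X U μ) {F : α × β → ℝ≥0∞} (hF : Measurable F) :
    ∫⁻ ω, F (X ω, U ω) ∂μ = ∫⁻ ω, ∫⁻ e, F (X ω, e) ∂(μ.map U) ∂μ := by
  have : IsProbabilityMeasure (μ.map U) := Measure.isProbabilityMeasure_map hU.aemeasurable
  rw [← lintegral_map hF (hX.prodMk hU), (indepFun_iff_map_prod_eq_prod_map_map hX.aemeasurable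
    hU.aemeasurable).1 h, lintegral_prod _ hF.aemeasurable,
    lintegral_map hF.lintegral_prod_right' hX]

/-- Independence of a σ-algebra `m` from U is independence of U from the identity map into (Ω, m).
This lets the integrand depend on ω itself rather than on a chosen random variable. -/
lemma lintegral_comp_of_indep {Ω β : Type*} {m mΩ : MeasurableSpace Ω} [MeasurableSpace β]
    {μ : Measure Ω} [IsProbabilityMeasure μ] (hm : m ≤ mΩ) {U : Ω → β}
    (hU : Measurable U) (h : Indep m (MeasurableSpace.comap U inferInstance) μ)
    {F : Ω × β → ℝ≥0∞} (hF : Measurable[m.prod inferInstance] F) :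
    ∫⁻ ω, F (ω, U ω) ∂μ = ∫⁻ ω, ∫⁻ e, F (ω, e) ∂(μ.map U) ∂μ := by
  have hid : @Measurable Ω Ω mΩ m id := measurable_id'' hm
  have hind : @IndepFun Ω Ω β mΩ m _ id U μ := by
    have := @IndepFun_iff_Indep Ω Ω β mΩ m _ id U μ
    rw [this, MeasurableSpace.comap_id]
    exact h
  exact @lintegral_comp_of_indepFun Ω Ω β mΩ m _ μ _ id U hid hU hind F hF

/-- The triple has the product law; only its association changes. -/
lemma IndepFun.prodMk_left_of_prodMk_right {X : Ω → α} {U : Ω → β} {V : Ω → γ}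
    (hX : Measurable X) (hU : Measurable U) (hV : Measurable V)
    (h : IndepFun X (fun ω => (U ω, V ω)) μ) (h' : IndepFun U V μ) :
    IndepFun (fun ω => (X ω, U ω)) V μ := by
  have : IsProbabilityMeasure (μ.map U) := Measure.isProbabilityMeasure_map hU.aemeasurable
  have : IsProbabilityMeasure (μ.map V) := Measure.isProbabilityMeasure_map hV.aemeasurable
  have : IsProbabilityMeasure (μ.map X) := Measure.isProbabilityMeasure_map hX.aemeasurable
  have hXU : IndepFun X U μ := h.comp measurable_id measurable_fst
  rw [indepFun_iff_map_prod_eq_prod_map_map (hX.prodMk hU).aemeasurable hV.aemeasurable,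
    (indepFun_iff_map_prod_eq_prod_map_map hX.aemeasurable hU.aemeasurable).1 hXU]
  have h1 := (indepFun_iff_map_prod_eq_prod_map_map hX.aemeasurable
    (hU.prodMk hV).aemeasurable).1 h
  rw [(indepFun_iff_map_prod_eq_prod_map_map hU.aemeasurable hV.aemeasurable).1 h'] at h1
  have h2 : μ.map (fun ω => ((X ω, U ω), V ω)) =
      (μ.map fun ω => (X ω, (U ω, V ω))).map MeasurableEquiv.prodAssoc.symm := by
    rw [Measure.map_map MeasurableEquiv.prodAssoc.symm.measurable (hX.prodMk (hU.prodMk hV))]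
    rfl
  rw [h2, h1]
  exact (measurePreserving_prodAssoc (μ.map X) (μ.map U) (μ.map V)).symm.map_eq

end Independence

variable {Ω : Type u}

/-- The information carried by the whole path of `Y`. -/
abbrev pathInfo (Y : ℝ≥0 → Ω → ℝ) : MeasurableSpace Ω :=
  ⨆ t, MeasurableSpace.comap (Y t) inferInstance

/-- The information carried by the whole path of `Y` and the first `n` durations. -/
abbrev clockInfo (Y : ℝ≥0 → Ω → ℝ) (W : ℕ → Ω → ℝ≥0) (n : ℕ) : MeasurableSpace Ω :=
  pathInfo Y ⊔ ⨆ i ∈ Finset.range n, MeasurableSpace.comap (W i) inferInstance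

/-- The information available at the `n`-th observation, before completion. -/
abbrev rawObsInfo (Y : ℝ≥0 → Ω → ℝ) (W : ℕ → Ω → ℝ≥0) (n : ℕ) : MeasurableSpace Ω :=
  (⨆ i ∈ Finset.range (n + 1), MeasurableSpace.comap (obsState Y W i) inferInstance) ⊔
      ⨆ i ∈ Finset.range n, MeasurableSpace.comap (W i) inferInstance

/-- The exponential law, on `[0, ∞)`. -/
def clockLaw (l : ℝ) : Measure ℝ≥0 := (expMeasure l).map Real.toNNReal

lemma isProbabilityMeasure_clockLaw {l : ℝ} (hl : 0 < l) : IsProbabilityMeasure (clockLaw l) := by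
  have := isProbabilityMeasure_expMeasure hl
  exact Measure.isProbabilityMeasure_map measurable_real_toNNReal.aemeasurable

lemma measurable_pathInfo (Y : ℝ≥0 → Ω → ℝ) (t : ℝ≥0) : Measurable[pathInfo Y] (Y t) :=
  Measurable.of_comap_le (le_iSup (fun t => MeasurableSpace.comap (Y t) inferInstance) t)

lemma measurable_clock {W : ℕ → Ω → ℝ≥0} {n i : ℕ} (hi : i < n) :
    Measurable[⨆ i ∈ Finset.range n, MeasurableSpace.comap (W i) inferInstance] (W i) :=
  Measurable.of_comap_le (le_iSup₂_of_le i (Finset.mem_range.2 hi) le_rfl)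

lemma measurable_obsTime_of {m : MeasurableSpace Ω} {W : ℕ → Ω → ℝ≥0} {n : ℕ}
    (h : ∀ i < n, Measurable (W i)) : Measurable (obsTime W n) := by
  unfold obsTime
  exact Finset.measurable_fun_sum _ fun i hi => h i (Finset.mem_range.1 hi)

lemma measurable_obsState_of {m : MeasurableSpace Ω} {Y : ℝ≥0 → Ω → ℝ} {W : ℕ → Ω → ℝ≥0}
    (hc : ∀ ω, IsCadlag fun t => Y t ω) (hY : ∀ t, Measurable (Y t)) {n : ℕ}
    (h : ∀ i < n, Measurable (W i)) : Measurable (obsState Y W n) :=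
  (measurable_uncurry_of_rightContinuous hY fun ω => (hc ω).1).comp
    (measurable_id.prodMk (measurable_obsTime_of h))

lemma measurable_shift_of {m : MeasurableSpace Ω} {Y : ℝ≥0 → Ω → ℝ}
    (hc : ∀ ω, IsCadlag fun t => Y t ω) (hY : ∀ t, Measurable (Y t)) {T : Ω → ℝ≥0}
    (hT : Measurable T) : Measurable fun p : Ω × ℝ≥0 => Y (T p.1 + p.2) p.1 :=
  (measurable_uncurry_of_rightContinuous hY fun ω => (hc ω).1).comp
    (measurable_fst.prodMk ((hT.comp measurable_fst).add measurable_snd))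

lemma rawObsInfo_le_clockInfo {Y : ℝ≥0 → Ω → ℝ} {W : ℕ → Ω → ℝ≥0}
    (hc : ∀ ω, IsCadlag fun t => Y t ω) (n : ℕ) : rawObsInfo Y W n ≤ clockInfo Y W n := by
  refine sup_le (iSup₂_le fun i hi => ?_) le_sup_right
  refine Measurable.comap_le (measurable_obsState_of hc (fun t => ?_) fun j hj => ?_)
  · exact (measurable_pathInfo Y t).mono le_sup_left le_rfl
  · refine (measurable_clock (n := n) ?_).mono le_sup_right le_rfl
    have := Finset.mem_range.1 hi
    omega

lemma measurable_obsTime_raw (Y : ℝ≥0 → Ω → ℝ) (W : ℕ → Ω → ℝ≥0) (n : ℕ) :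
    Measurable[rawObsInfo Y W n] (obsTime W n) :=
  measurable_obsTime_of fun _ hi => (measurable_clock hi).mono le_sup_right le_rfl

lemma measurable_obsState_raw (Y : ℝ≥0 → Ω → ℝ) (W : ℕ → Ω → ℝ≥0) (n : ℕ) :
    Measurable[rawObsInfo Y W n] (obsState Y W n) :=
  Measurable.of_comap_le <| le_sup_of_le_left <|
    le_iSup₂_of_le n (Finset.mem_range.2 n.lt_succ_self) le_rfl

lemma monotone_rawObsInfo (Y : ℝ≥0 → Ω → ℝ) (W : ℕ → Ω → ℝ≥0) : Monotone (rawObsInfo Y W) := by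
  intro n k hnk
  refine sup_le_sup ?_ ?_ <;>
  refine iSup₂_le fun i hi => le_iSup₂_of_le i (Finset.mem_range.2 ?_) le_rfl <;>
  · have := Finset.mem_range.1 hi
    omega

variable [mΩ : MeasurableSpace Ω] {P : ℝ → Measure Ω} {Y : ℝ≥0 → Ω → ℝ} {W : ℕ → Ω → ℝ≥0} {l : ℝ}

lemma IsCadlagMarkovProcess.pathInfo_le (hY : IsCadlagMarkovProcess P Y) : pathInfo Y ≤ mΩ :=
  iSup_le fun t => (hY.measurable t).comap_le

lemma clockInfo_le (hY : IsCadlagMarkovProcess P Y) (hW : IsExponentialClock P Y W l) (n : ℕ) :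
    clockInfo Y W n ≤ mΩ :=
  sup_le hY.pathInfo_le (iSup₂_le fun i _ => (hW.measurable i).comap_le)

lemma IsExponentialClock.map_eq (hW : IsExponentialClock P Y W l) (x : ℝ) (n : ℕ) :
    (P x).map (W n) = clockLaw l := by
  have h : Measurable fun ω => (W n ω : ℝ) := measurable_coe_nnreal_real.comp (hW.measurable n)
  rw [clockLaw, ← hW.law x n, Measure.map_map measurable_real_toNNReal h]
  congr 1
  ext ω
  simp

lemma indep_pathInfo_clock (hW : IsExponentialClock P Y W l) (x : ℝ) :
    Indep (pathInfo Y) (MeasurableSpace.comap (fun ω n => W n ω) inferInstance) (P x) := by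
  have h := (IndepFun_iff_Indep _ _ _).1 (hW.indep x)
  refine indep_of_indep_of_le_left h (iSup_le fun t => ?_)
  have : Measurable[MeasurableSpace.comap (fun ω t => Y t ω) inferInstance] (Y t) :=
    (measurable_pi_apply t).comp (comap_measurable fun ω t => Y t ω)
  exact this.comap_le

/-- The path is independent of the whole clock and the durations are mutually independent, so the
first n durations can be moved to the side of the path. -/
lemma indep_clockInfo_clock (hY : IsCadlagMarkovProcess P Y) (hW : IsExponentialClock P Y W l)
    (x : ℝ) (n : ℕ) :
    Indep (clockInfo Y W n) (MeasurableSpace.comap (W n) inferInstance) (P x) := by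
  have := hY.isProbabilityMeasure x
  have hYm : Measurable fun ω t => Y t ω := measurable_pi_lambda _ hY.measurable
  have hU : Measurable fun ω (i : Finset.range n) => W i ω :=
    measurable_pi_lambda _ fun i => hW.measurable i
  have hg : Measurable fun w : ℕ → ℝ≥0 => ((fun i : Finset.range n => w i), w n) :=
    (measurable_pi_lambda _ fun i => measurable_pi_apply _).prodMk (measurable_pi_apply n)
  have h1 : IndepFun (fun ω t => Y t ω) (fun ω => ((fun i : Finset.range n => W i ω), W n ω))
      (P x) := (hW.indep x).comp measurable_id hg
  have h2 : IndepFun (fun ω (i : Finset.range n) => W i ω) (W n) (P x) := by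
    have := (hW.iIndep x).indepFun_finset (Finset.range n) {n} (by simp) hW.measurable
    exact this.comp measurable_id
      (measurable_pi_apply (⟨n, Finset.mem_singleton_self n⟩ : ({n} : Finset ℕ)))
  have h3 := IndepFun.prodMk_left_of_prodMk_right hYm hU (hW.measurable n) h1 h2
  let φ : Ω → (ℝ≥0 → ℝ) × (Finset.range n → ℝ≥0) := fun ω => (fun t => Y t ω, fun i => W i ω)
  refine indep_of_indep_of_le_left ((IndepFun_iff_Indep φ _ _).1 h3) (sup_le (iSup_le fun t => ?_)
    (iSup₂_le fun i hi => ?_))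
  · have : Measurable[MeasurableSpace.comap φ inferInstance] (Y t) :=
      (measurable_pi_apply t).comp (measurable_fst.comp (comap_measurable φ))
    exact this.comap_le
  · have : Measurable[MeasurableSpace.comap φ inferInstance] (W i) :=
      (measurable_pi_apply (⟨i, hi⟩ : Finset.range n)).comp
        (measurable_snd.comp (comap_measurable φ))
    exact this.comap_le

/-- The `n`-th duration can be integrated out, given the path and the previous durations. -/
lemma lintegral_comp_clock (hY : IsCadlagMarkovProcess P Y) (hW : IsExponentialClock P Y W l)
    (x : ℝ) (n : ℕ) {F : Ω × ℝ≥0 → ℝ≥0∞}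
    (hF : Measurable[(clockInfo Y W n).prod inferInstance] F) :
    ∫⁻ ω, F (ω, W n ω) ∂(P x) = ∫⁻ ω, ∫⁻ t, F (ω, t) ∂(clockLaw l) ∂(P x) := by
  have := hY.isProbabilityMeasure x
  rw [← hW.map_eq x n]
  exact lintegral_comp_of_indep (clockInfo_le hY hW n) (hW.measurable n)
    (indep_clockInfo_clock hY hW x n) hF

/-- The transition kernel of a càdlàg Markov process, jointly in time and starting point. -/
def IsCadlagMarkovProcess.kernel (hY : IsCadlagMarkovProcess P Y) : Kernel (ℝ≥0 × ℝ) ℝ where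
  toFun p := (P p.2).map (Y p.1)
  measurable' := by
    have := hY.isProbabilityMeasure
    have (p : ℝ≥0 × ℝ) : IsProbabilityMeasure ((P p.2).map (Y p.1)) :=
      Measure.isProbabilityMeasure_map (hY.measurable _).aemeasurable
    refine Measurable.measure_of_isPiSystem_of_isProbabilityMeasure
      (borel_eq_generateFrom_Iic ℝ ▸ BorelSpace.measurable_eq) (isPiSystem_Iic) ?_
    rintro _ ⟨a, rfl⟩
    have hmeas (p : ℝ≥0 × ℝ) : (P p.2).map (Y p.1) (Set.Iic a) =
        ENNReal.ofReal ((P p.2).real (Y p.1 ⁻¹' Set.Iic a)) := by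
      rw [Measure.map_apply (hY.measurable _) measurableSet_Iic, ofReal_measureReal]
    simp_rw [hmeas]
    refine ENNReal.measurable_ofReal.comp ?_
    -- Continuous ramps equal to 1 on (-∞, a] and decreasing pointwise to its indicator. Continuity
    -- is what makes t ↦ E_y[ψ(Y(t))] right-continuous, hence jointly measurable in (t, y).
    let ψ : ℕ → ℝ → ℝ := fun k z => max 0 (min 1 (1 - k * (z - a)))
    have hψc : ∀ k, Continuous (ψ k) := fun k => by fun_prop
    have hψb : ∀ k z, ‖ψ k z‖ ≤ 1 := fun k z => by
      rw [Real.norm_eq_abs, abs_le]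
      constructor
      · have : 0 ≤ ψ k z := le_max_left _ _
        linarith
      · exact max_le zero_le_one (min_le_left _ _)
    refine measurable_of_tendsto_metrizable
      (f := fun k (p : ℝ≥0 × ℝ) => ∫ ω, ψ k (Y p.1 ω) ∂(P p.2)) (fun k => ?_) ?_
    · have h1 : Measurable fun p : ℝ × ℝ≥0 => ∫ ω, ψ k (Y p.2 ω) ∂(P p.1) := by
        refine measurable_uncurry_of_rightContinuous
          (u := fun t y => ∫ ω, ψ k (Y t ω) ∂(P y)) (fun t => ?_) fun y t => ?_
        · let κ : Kernel ℝ ℝ := ⟨fun y => (P y).map (Y t), by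
            refine Measure.measurable_of_measurable_coe _ fun A hA => ?_
            simp_rw [Measure.map_apply (hY.measurable t) hA]
            exact hY.measurable_transition t A hA⟩
          have : (fun y => ∫ ω, ψ k (Y t ω) ∂(P y)) = fun y => ∫ z, ψ k z ∂(κ y) := by
            ext y
            exact (integral_map (hY.measurable t).aemeasurable
              (hψc k).aestronglyMeasurable).symm
          rw [this]
          have : IsMarkovKernel κ := ⟨fun y =>
            Measure.isProbabilityMeasure_map (hY.measurable _).aemeasurable⟩
          exact ((hψc k).stronglyMeasurable.integral_kernel (κ := κ)).measurable
        · refine tendsto_integral_filter_of_dominated_convergence (fun _ => 1)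
            (Eventually.of_forall fun s => ((hψc k).measurable.comp
              (hY.measurable s)).aestronglyMeasurable)
            (Eventually.of_forall fun s => Eventually.of_forall fun ω => hψb k _)
            (integrable_const _) (Eventually.of_forall fun ω => ?_)
          exact ((hψc k).tendsto _).comp ((hY.cadlag ω).1 t)
      exact h1.comp measurable_swap
    · rw [tendsto_pi_nhds]
      rintro ⟨t, y⟩
      have h2 : (P y).real (Y t ⁻¹' Set.Iic a) =
          ∫ ω, (Y t ⁻¹' Set.Iic a).indicator (fun _ => (1 : ℝ)) ω ∂(P y) := by
        rw [integral_indicator_const _ (hY.measurable t measurableSet_Iic)]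
        simp
      simp only [h2]
      refine tendsto_integral_of_dominated_convergence (fun _ => 1)
        (fun k => ((hψc k).measurable.comp (hY.measurable t)).aestronglyMeasurable)
        (integrable_const _) (fun k => Eventually.of_forall fun ω => hψb k _)
        (Eventually.of_forall fun ω => ?_)
      by_cases hω : Y t ω ≤ a
      · rw [Set.indicator_of_mem (by exact hω)]
        refine tendsto_const_nhds.congr fun k => ?_
        have : (0 : ℝ) ≤ k * (a - Y t ω) := by
          have : 0 ≤ a - Y t ω := by linarith
          positivity
        dsimp only [ψ]
        rw [min_eq_left (by linarith), max_eq_right zero_le_one]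
      · rw [Set.indicator_of_notMem (by exact hω)]
        push Not at hω
        obtain ⟨N, hN⟩ := exists_nat_gt (1 / (Y t ω - a))
        refine tendsto_const_nhds.congr' ?_
        filter_upwards [eventually_ge_atTop N] with k hk
        have hpos : 0 < Y t ω - a := by linarith
        rw [div_lt_iff₀ hpos] at hN
        have : (N : ℝ) * (Y t ω - a) ≤ k * (Y t ω - a) := by gcongr
        dsimp only [ψ]
        rw [max_eq_left]
        exact (min_le_right _ _).trans (by linarith)

lemma IsCadlagMarkovProcess.kernel_apply (hY : IsCadlagMarkovProcess P Y) (t : ℝ≥0) (y : ℝ) :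
    hY.kernel (t, y) = (P y).map (Y t) := rfl

instance (hY : IsCadlagMarkovProcess P Y) : IsMarkovKernel hY.kernel :=
  ⟨fun p => by
    have := hY.isProbabilityMeasure p.2
    exact Measure.isProbabilityMeasure_map (hY.measurable _).aemeasurable⟩

lemma IsCadlagMarkovProcess.lintegral_kernel (hY : IsCadlagMarkovProcess P Y) {f : ℝ → ℝ≥0∞}
    (hf : Measurable f) (t : ℝ≥0) (y : ℝ) :
    ∫⁻ z, f z ∂(hY.kernel (t, y)) = ∫⁻ ω, f (Y t ω) ∂(P y) :=
  lintegral_map hf (hY.measurable t)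

/-- The kernel of the observed chain, discounted at rate `q`. -/
def discountedKernel (hY : IsCadlagMarkovProcess P Y) (q l : ℝ) : Kernel ℝ ℝ :=
  hY.kernel ∘ₖ (Kernel.const ℝ ((clockLaw l).withDensity fun t =>
    ENNReal.ofReal (Real.exp (-q * t))) ×ₖ Kernel.id)

lemma measurable_discount (q : ℝ) :
    Measurable fun t : ℝ≥0 => ENNReal.ofReal (Real.exp (-q * t)) := by fun_prop

lemma lintegral_discountedKernel (hY : IsCadlagMarkovProcess P Y) (q : ℝ) (hl : 0 < l)
    {f : ℝ → ℝ≥0∞} (hf : Measurable f) (y : ℝ) :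
    ∫⁻ z, f z ∂(discountedKernel hY q l y) =
      ∫⁻ t, ENNReal.ofReal (Real.exp (-q * t)) * ∫⁻ z, f z ∂(hY.kernel (t, y)) ∂(clockLaw l) := by
  have := isProbabilityMeasure_clockLaw hl
  have hm : Measurable fun p : ℝ≥0 × ℝ => ∫⁻ z, f z ∂(hY.kernel p) := hf.lintegral_kernel
  rw [discountedKernel, Kernel.lintegral_comp _ _ _ hf, Kernel.prod_apply,
    lintegral_prod _ hm.aemeasurable, Kernel.const_apply]
  simp only [Kernel.id_apply]
  have (a : ℝ≥0) : ∫⁻ b, ∫⁻ z, f z ∂(hY.kernel (a, b)) ∂(Measure.dirac y) =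
      ∫⁻ z, f z ∂(hY.kernel (a, y)) :=
    lintegral_dirac' _ (hm.comp (measurable_const.prodMk measurable_id))
  simp_rw [this]
  exact lintegral_withDensity_eq_lintegral_mul _ (measurable_discount q)
    (hm.comp (measurable_id.prodMk measurable_const))

end Paths

/-! ### Optimal stopping of a discounted chain with a monotone kernel -/

section DiscountedChain

/-- The action of a kernel on nonnegative functions, `f ↦ ∫ f dK(y)`. -/
def kernelOp (K : Kernel ℝ ℝ) (f : ℝ → ℝ≥0∞) (y : ℝ) : ℝ≥0∞ := ∫⁻ z, f z ∂(K y)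

lemma kernelOp_mono (K : Kernel ℝ ℝ) {f g : ℝ → ℝ≥0∞} (h : f ≤ g) :
    kernelOp K f ≤ kernelOp K g := fun _ => lintegral_mono h

lemma measurable_kernelOp (K : Kernel ℝ ℝ) {f : ℝ → ℝ≥0∞} (hf : Measurable f) :
    Measurable (kernelOp K f) := hf.lintegral_kernel

lemma measurable_kernelOp_iterate (K : Kernel ℝ ℝ) {f : ℝ → ℝ≥0∞} (hf : Measurable f) (n : ℕ) :
    Measurable ((kernelOp K)^[n] f) := by
  induction n with
  | zero => exact hf
  | succ n ih => rw [Function.iterate_succ_apply']; exact measurable_kernelOp K ih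

/-- The potential `∑ Kⁿ f`. -/
def potential (K : Kernel ℝ ℝ) (f : ℝ → ℝ≥0∞) (y : ℝ) : ℝ≥0∞ := ∑' n, (kernelOp K)^[n] f y

lemma kernelOp_potential (K : Kernel ℝ ℝ) {f : ℝ → ℝ≥0∞} (hf : Measurable f) (y : ℝ) :
    f y + kernelOp K (potential K f) y = potential K f y := by
  unfold potential
  rw [tsum_eq_zero_add' ENNReal.summable, kernelOp,
    lintegral_tsum fun n => (measurable_kernelOp_iterate K hf n).aemeasurable]
  simp [Function.iterate_succ_apply', kernelOp]

/-- The Bellman operator of the stopping problem with gain `p`, loss `m` and kernel `K`. -/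
def bellman (K : Kernel ℝ ℝ) (p m : ℝ → ℝ≥0∞) : (ℝ → ℝ≥0∞) →o (ℝ → ℝ≥0∞) where
  toFun f y := p y + kernelOp K f y - m y
  monotone' _ _ h y := tsub_le_tsub_right (add_le_add_right (kernelOp_mono K h y) _) _

/-- The value function of the stopping problem: the least solution of Bellman's equation. -/
def stoppingValue (K : Kernel ℝ ℝ) (p m : ℝ → ℝ≥0∞) : ℝ → ℝ≥0∞ := (bellman K p m).lfp

/-- Subtraction in [0, ∞] is truncated, so this is V = (p + KV - m)^+, the truncation being the
option to stop at once. -/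
lemma stoppingValue_eq (K : Kernel ℝ ℝ) (p m : ℝ → ℝ≥0∞) (y : ℝ) :
    p y + kernelOp K (stoppingValue K p m) y - m y = stoppingValue K p m y :=
  congrFun (bellman K p m).map_lfp y

/-- Without losses and without stopping one collects the whole potential, which is a super-solution.
This bound supplies the finiteness of V and the control of the remainder at infinity. -/
lemma stoppingValue_le_potential (K : Kernel ℝ ℝ) {p : ℝ → ℝ≥0∞} (hp : Measurable p)
    (m : ℝ → ℝ≥0∞) : stoppingValue K p m ≤ potential K p := by
  refine OrderHom.lfp_le _ fun y => ?_
  change p y + kernelOp K (potential K p) y - m y ≤ _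
  rw [kernelOp_potential K hp]
  exact tsub_le_self

/-- Fixed-point induction: monotonicity survives the Bellman operator and pointwise suprema. It also
provides the measurability of V, which a least fixed point does not carry by itself. -/
lemma monotone_stoppingValue {K : Kernel ℝ ℝ}
    (hK : ∀ f : ℝ → ℝ≥0∞, Monotone f → Monotone (kernelOp K f))
    {p m : ℝ → ℝ≥0∞} (hp : Monotone p) (hm : Antitone m) : Monotone (stoppingValue K p m) := by
  refine OrderHom.lfp_induction (p := fun f : ℝ → ℝ≥0∞ => Monotone f) _ ?_ ?_
  · intro f hf _ y z hyz
    exact tsub_le_tsub (add_le_add (hp hyz) (hK f hf hyz)) (hm hyz)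
  · intro s hs y z hyz
    rw [sSup_apply, sSup_apply]
    exact iSup_mono fun f => hs f f.2 hyz

/-- A discounted Markov chain: `D n` is the discount factor at step `n`, `X n` the state, `F n` the
information; `K` is the discounted transition kernel. -/
structure IsDiscountedChain {Ω : Type u} [mΩ : MeasurableSpace Ω] (μ : Measure Ω)
    (K : Kernel ℝ ℝ) (F : ℕ → MeasurableSpace Ω) (D : ℕ → Ω → ℝ≥0∞) (X : ℕ → Ω → ℝ)
    (x : ℝ) : Prop where
  le : ∀ n, F n ≤ mΩ
  mono : Monotone F
  measurable_state : ∀ n, Measurable[F n] (X n)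
  measurable_discount : ∀ n, Measurable[F n] (D n)
  antitone : ∀ ω, Antitone fun n => D n ω
  discount_zero : ∀ ω, D 0 ω = 1
  start : ∀ᵐ ω ∂μ, X 0 ω = x
  step : ∀ n (A : Set Ω), MeasurableSet[F n] A → ∀ f : ℝ → ℝ≥0∞, Measurable f →
    ∫⁻ ω in A, D (n + 1) ω * f (X (n + 1) ω) ∂μ = ∫⁻ ω in A, D n ω * kernelOp K f (X n ω) ∂μ

/-- The first step `n ≥ 1` at which the state is at or below `x`. -/
def firstStepBelow {Ω : Type u} (X : ℕ → Ω → ℝ) (x : ℝ) (ω : Ω) : ℕ∞ :=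
  sInf {N | ∃ n : ℕ, N = n ∧ 0 < n ∧ X n ω ≤ x}

lemma lt_firstStepBelow_iff {Ω : Type u} {X : ℕ → Ω → ℝ} {x : ℝ} {ω : Ω} {n : ℕ} :
    (n : ℕ∞) < firstStepBelow X x ω ↔ ∀ k, 0 < k → k ≤ n → x < X k ω := by
  constructor
  · intro h k hk hkn
    by_contra! hx
    have : firstStepBelow X x ω ≤ k := sInf_le ⟨k, rfl, hk, hx⟩
    exact absurd (h.trans_le this) (by exact_mod_cast hkn.not_gt)
  · intro h
    refine lt_of_lt_of_le (b := ((n + 1 : ℕ) : ℕ∞)) (by exact_mod_cast n.lt_succ_self) ?_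
    refine le_sInf ?_
    rintro _ ⟨k, rfl, hk, hkx⟩
    by_contra! hc
    have : k ≤ n := by
      have : k < n + 1 := by exact_mod_cast hc
      omega
    exact absurd (h k hk this) hkx.not_gt

lemma firstStepBelow_pos {Ω : Type u} (X : ℕ → Ω → ℝ) (x : ℝ) (ω : Ω) :
    0 < firstStepBelow X x ω := by
  have := (lt_firstStepBelow_iff (X := X) (x := x) (ω := ω) (n := 0)).2 (by intro k; omega)
  simpa using this

namespace IsDiscountedChain

variable {Ω : Type u} [mΩ : MeasurableSpace Ω] {μ : Measure Ω} {K : Kernel ℝ ℝ}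
  {F : ℕ → MeasurableSpace Ω} {D : ℕ → Ω → ℝ≥0∞} {X : ℕ → Ω → ℝ} {x : ℝ}

lemma measurable_state' (h : IsDiscountedChain μ K F D X x) (n : ℕ) : Measurable (X n) :=
  (h.measurable_state n).mono (h.le n) le_rfl

lemma measurable_discount' (h : IsDiscountedChain μ K F D X x) (n : ℕ) : Measurable (D n) :=
  (h.measurable_discount n).mono (h.le n) le_rfl

lemma measurable_mul (h : IsDiscountedChain μ K F D X x) {f : ℝ → ℝ≥0∞} (hf : Measurable f)
    (n : ℕ) : Measurable fun ω => D n ω * f (X n ω) :=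
  (h.measurable_discount' n).mul (hf.comp (h.measurable_state' n))

lemma lintegral_start [IsProbabilityMeasure μ] (h : IsDiscountedChain μ K F D X x)
    (f : ℝ → ℝ≥0∞) : ∫⁻ ω, D 0 ω * f (X 0 ω) ∂μ = f x := by
  have : (fun ω => D 0 ω * f (X 0 ω)) =ᵐ[μ] fun _ => f x := by
    filter_upwards [h.start] with ω hω
    rw [hω, h.discount_zero, one_mul]
  rw [lintegral_congr_ae this]
  simp

lemma lintegral_iterate [IsProbabilityMeasure μ] (h : IsDiscountedChain μ K F D X x)
    (n : ℕ) {f : ℝ → ℝ≥0∞} (hf : Measurable f) :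
    ∫⁻ ω, D n ω * f (X n ω) ∂μ = (kernelOp K)^[n] f x := by
  induction n generalizing f with
  | zero => exact h.lintegral_start f
  | succ n ih =>
    have := h.step n Set.univ MeasurableSet.univ f hf
    simp only [Measure.restrict_univ] at this
    rw [this, ih (measurable_kernelOp K hf), Function.iterate_succ_apply]

lemma tsum_lintegral [IsProbabilityMeasure μ] (h : IsDiscountedChain μ K F D X x)
    {f : ℝ → ℝ≥0∞} (hf : Measurable f) :
    ∑' n, ∫⁻ ω, D n ω * f (X n ω) ∂μ = potential K f x :=
  tsum_congr fun n => h.lintegral_iterate n hf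

/-- The expected discounted potential at step n is the tail of the series that defines it at x, so
it tends to 0 when that series converges. -/
lemma lintegral_potential [IsProbabilityMeasure μ] (h : IsDiscountedChain μ K F D X x)
    {f : ℝ → ℝ≥0∞} (hf : Measurable f) (n : ℕ) :
    ∫⁻ ω, D n ω * potential K f (X n ω) ∂μ = ∑' k, (kernelOp K)^[k + n] f x := by
  simp only [potential]
  simp_rw [← ENNReal.tsum_mul_left]
  rw [lintegral_tsum fun k =>
    (h.measurable_mul (measurable_kernelOp_iterate K hf k) n).aemeasurable]
  refine tsum_congr fun k => ?_
  rw [h.lintegral_iterate n (measurable_kernelOp_iterate K hf k), ← Function.iterate_add_apply,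
    add_comm]

/-- Verification: no stopping rule gains more than the value. -/
lemma gain_le_value_add_loss [IsProbabilityMeasure μ] (h : IsDiscountedChain μ K F D X x)
    (hK : ∀ f : ℝ → ℝ≥0∞, Monotone f → Monotone (kernelOp K f))
    {p m : ℝ → ℝ≥0∞} (hp : Monotone p) (hm : Antitone m)
    {A : ℕ → Set Ω} (hA : ∀ n, MeasurableSet[F n] (A n)) (hA' : ∀ n, A (n + 1) ≤ᵐ[μ] A n) :
    ∑' n, ∫⁻ ω in A n, D n ω * p (X n ω) ∂μ ≤
      stoppingValue K p m x + ∑' n, ∫⁻ ω in A n, D n ω * m (X n ω) ∂μ := by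
  set V := stoppingValue K p m with hV
  have hVm : Measurable V := (monotone_stoppingValue hK hp hm).measurable
  have key : ∀ n, ∫⁻ ω in A n, D n ω * p (X n ω) ∂μ + ∫⁻ ω in A (n + 1), D (n + 1) ω *
      V (X (n + 1) ω) ∂μ ≤ ∫⁻ ω in A n, D n ω * V (X n ω) ∂μ +
        ∫⁻ ω in A n, D n ω * m (X n ω) ∂μ := by
    intro n
    calc _ ≤ ∫⁻ ω in A n, D n ω * p (X n ω) ∂μ +
          ∫⁻ ω in A n, D n ω * kernelOp K V (X n ω) ∂μ := by
          rw [← h.step n (A n) (hA n) V hVm]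
          exact add_le_add_right (lintegral_mono' (Measure.restrict_mono' (hA' n) le_rfl) le_rfl) _
      _ = ∫⁻ ω in A n, D n ω * (p (X n ω) + kernelOp K V (X n ω)) ∂μ := by
          rw [← lintegral_add_left (h.measurable_mul hp.measurable n)]
          simp_rw [mul_add]
      _ ≤ ∫⁻ ω in A n, D n ω * (V (X n ω) + m (X n ω)) ∂μ := by
          refine lintegral_mono fun ω => ?_
          dsimp only
          refine mul_le_mul_right ?_ _
          have h1 := stoppingValue_eq K p m (X n ω)
          exact tsub_le_iff_right.1 h1.le
      _ = _ := by
          simp_rw [mul_add]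
          rw [← lintegral_add_left (h.measurable_mul hVm n)]
  -- Telescoping `key`: the V term produced at step n + 1 is the one consumed by the next
  -- inequality.
  have ind : ∀ N, ∑ n ∈ Finset.range N, ∫⁻ ω in A n, D n ω * p (X n ω) ∂μ +
      ∫⁻ ω in A N, D N ω * V (X N ω) ∂μ ≤
      V x + ∑ n ∈ Finset.range N, ∫⁻ ω in A n, D n ω * m (X n ω) ∂μ := by
    intro N
    induction N with
    | zero =>
      simp only [Finset.range_zero, Finset.sum_empty, zero_add, add_zero]
      rw [← h.lintegral_start V]
      exact setLIntegral_le_lintegral _ _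
    | succ N ih =>
      rw [Finset.sum_range_succ, Finset.sum_range_succ, add_assoc]
      calc _ ≤ _ := add_le_add_right (key N) _
        _ ≤ _ := by rw [← add_assoc, ← add_assoc]; exact add_le_add_left ih _
  refine ENNReal.tsum_le_of_sum_range_le fun N => ?_
  exact (le_self_add.trans (ind N)).trans (add_le_add_right (ENNReal.sum_le_tsum _) _)

lemma measurableSet_lt_firstStepBelow (h : IsDiscountedChain μ K F D X x) (n : ℕ) :
    MeasurableSet[F n] {ω | (n : ℕ∞) < firstStepBelow X x ω} := by
  have : {ω | (n : ℕ∞) < firstStepBelow X x ω} =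
      ⋂ k : ℕ, ⋂ _ : 0 < k, ⋂ _ : k ≤ n, X k ⁻¹' Set.Ioi x := by
    ext ω
    simp only [Set.mem_ofPred_eq, lt_firstStepBelow_iff, Set.mem_iInter, Set.mem_preimage,
      Set.mem_Ioi]
  rw [this]
  refine MeasurableSet.iInter fun k => MeasurableSet.iInter fun _ => MeasurableSet.iInter fun hk =>
    h.mono hk _ (h.measurable_state k measurableSet_Ioi)

/-- If stopping at the first return to `(-∞, x]` is a fair game, then the game is worthless from
`x`. -/
lemma stoppingValue_eq_zero [IsProbabilityMeasure μ] (h : IsDiscountedChain μ K F D X x)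
    (hK : ∀ f : ℝ → ℝ≥0∞, Monotone f → Monotone (kernelOp K f))
    {p m : ℝ → ℝ≥0∞} (hp : Monotone p) (hm : Antitone m) (hpot : potential K p x ≠ ∞)
    (hD : ∫⁻ ω, D 1 ω ∂μ < 1)
    (hfair : ∑' n : ℕ, ∫⁻ ω in {ω | (n : ℕ∞) < firstStepBelow X x ω}, D n ω * p (X n ω) ∂μ =
      ∑' n : ℕ, ∫⁻ ω in {ω | (n : ℕ∞) < firstStepBelow X x ω}, D n ω * m (X n ω) ∂μ) :
    stoppingValue K p m x = 0 := by
  set A : ℕ → Set Ω := fun n => {ω | (n : ℕ∞) < firstStepBelow X x ω} with hAdef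
  have hA : ∀ n, MeasurableSet[F n] (A n) := h.measurableSet_lt_firstStepBelow
  have hAm : ∀ n, MeasurableSet (A n) := fun n => h.le n _ (hA n)
  have hA' : Antitone A := fun i j hij ω hω =>
    lt_of_le_of_lt (by exact_mod_cast hij) (show (j : ℕ∞) < _ from hω)
  have hVmono := monotone_stoppingValue hK hp hm
  have hVle := stoppingValue_le_potential K hp.measurable m
  have hVeq := stoppingValue_eq K p m
  set V := stoppingValue K p m with hV
  have hVm : Measurable V := hVmono.measurable
  by_contra hne
  have hpos : 0 < V x := pos_iff_ne_zero.2 hne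
  -- V is positive on [x, ∞) by monotonicity, so the truncation in Bellman's equation is inactive
  -- there.
  have hfix : ∀ y, x ≤ y → V y + m y ≤ p y + kernelOp K V y := by
    intro y hy
    have h1 : 0 < V y := hpos.trans_le (hVmono hy)
    rw [← hVeq y] at h1 ⊢
    rw [tsub_add_cancel_of_le (tsub_pos_iff_lt.1 h1).le]
  have hstate : ∀ n, ∀ᵐ ω ∂μ, ω ∈ A n → x ≤ X n ω := by
    intro n
    filter_upwards [h.start] with ω h0 hω
    rcases Nat.eq_zero_or_pos n with rfl | hn
    · exact h0.ge
    · exact (lt_firstStepBelow_iff.1 hω n hn le_rfl).le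
  have key : ∀ n, ∫⁻ ω in A n, D n ω * V (X n ω) ∂μ + ∫⁻ ω in A n, D n ω * m (X n ω) ∂μ ≤
      ∫⁻ ω in A n, D n ω * p (X n ω) ∂μ + (∫⁻ ω in A (n + 1), D (n + 1) ω *
        V (X (n + 1) ω) ∂μ + V x * ∫⁻ ω in A n \ A (n + 1), D 1 ω ∂μ) := by
    intro n
    calc _ = ∫⁻ ω in A n, D n ω * (V (X n ω) + m (X n ω)) ∂μ := by
          simp_rw [mul_add]
          rw [← lintegral_add_left (h.measurable_mul hVm n)]
      _ ≤ ∫⁻ ω in A n, D n ω * (p (X n ω) + kernelOp K V (X n ω)) ∂μ := by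
          refine setLIntegral_mono_ae' (hAm n) ?_
          filter_upwards [hstate n] with ω hω hωA
          exact mul_le_mul_right (hfix _ (hω hωA)) _
      _ = ∫⁻ ω in A n, D n ω * p (X n ω) ∂μ +
          ∫⁻ ω in A n, D (n + 1) ω * V (X (n + 1) ω) ∂μ := by
          rw [h.step n (A n) (hA n) V hVm,
            ← lintegral_add_left (h.measurable_mul hp.measurable n)]
          simp_rw [mul_add]
      _ ≤ _ := by
          gcongr
          -- On A n \ A (n + 1) the rule stops at step n + 1, in a state ≤ x and with discount at
          -- most D 1. The value left there is therefore at most V x * D 1.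
          have hsplit : A n = A (n + 1) ∪ A n \ A (n + 1) :=
            (Set.union_sdiff_cancel (hA' n.le_succ)).symm
          conv_lhs => rw [hsplit]
          refine (lintegral_union_le _ _ _).trans ?_
          gcongr
          rw [← lintegral_const_mul _ (h.measurable_discount' 1)]
          refine setLIntegral_mono' ((hAm n).diff (hAm (n + 1))) fun ω hω => ?_
          rw [mul_comm]
          have hXx : X (n + 1) ω ≤ x := by
            by_contra! hx
            refine hω.2 (lt_firstStepBelow_iff.2 fun k hk hkn => ?_)
            rcases Nat.lt_or_ge n k with hnk | hnk
            · obtain rfl : k = n + 1 := by omega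
              exact hx
            · exact lt_firstStepBelow_iff.1 hω.1 k hk hnk
          gcongr
          · exact hVmono hXx
          · exact h.antitone ω (by omega)
  have ind : ∀ N, V x + ∑ n ∈ Finset.range N, ∫⁻ ω in A n, D n ω * m (X n ω) ∂μ ≤
      ∑ n ∈ Finset.range N, ∫⁻ ω in A n, D n ω * p (X n ω) ∂μ +
      (∫⁻ ω in A N, D N ω * V (X N ω) ∂μ +
        V x * ∑ n ∈ Finset.range N, ∫⁻ ω in A n \ A (n + 1), D 1 ω ∂μ) := by
    intro N
    induction N with
    | zero =>
      simp only [Finset.range_zero, Finset.sum_empty, zero_add, add_zero, mul_zero]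
      have : A 0 = Set.univ := by
        ext ω; simpa [hAdef] using firstStepBelow_pos X x ω
      rw [this, Measure.restrict_univ, h.lintegral_start V]
    | succ N ih =>
      rw [Finset.sum_range_succ, Finset.sum_range_succ, Finset.sum_range_succ, ← add_assoc]
      refine (add_le_add_left ih _).trans ?_
      have := key N
      set a := ∫⁻ ω in A N, D N ω * V (X N ω) ∂μ
      set b := ∫⁻ ω in A N, D N ω * m (X N ω) ∂μ
      set s := ∑ n ∈ Finset.range N, ∫⁻ ω in A n, D n ω * p (X n ω) ∂μ
      set t := ∑ n ∈ Finset.range N, ∫⁻ ω in A n \ A (n + 1), D 1 ω ∂μ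
      calc s + (a + V x * t) + b = s + V x * t + (a + b) := by ring
        _ ≤ _ := add_le_add_right this _
        _ = _ := by ring
  -- The stopping events A n \ A (n + 1) are disjoint, so together they carry at most the full mass
  -- of D 1.
  have hsum : ∀ N, ∑ n ∈ Finset.range N, ∫⁻ ω in A n \ A (n + 1), D 1 ω ∂μ ≤ ∫⁻ ω, D 1 ω ∂μ := by
    intro N
    have : ∀ N, ∑ n ∈ Finset.range N, ∫⁻ ω in A n \ A (n + 1), D 1 ω ∂μ +
        ∫⁻ ω in A N, D 1 ω ∂μ ≤ ∫⁻ ω, D 1 ω ∂μ := by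
      intro N
      induction N with
      | zero => simpa using setLIntegral_le_lintegral _ _
      | succ N ih =>
        rw [Finset.sum_range_succ, add_assoc, ← lintegral_union (hAm (N + 1))
          Set.disjoint_sdiff_left, Set.sdiff_union_of_subset (hA' N.le_succ)]
        exact ih
    exact le_self_add.trans (this N)
  set M := ∑' n, ∫⁻ ω in A n, D n ω * p (X n ω) ∂μ with hM
  have hMfin : M ≠ ∞ := by
    refine ne_top_of_le_ne_top hpot ?_
    rw [← h.tsum_lintegral hp.measurable]
    exact ENNReal.tsum_le_tsum fun n => setLIntegral_le_lintegral _ _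
  -- The unstopped remainder E[D_N V(X_N)] is dominated by this tail of the potential.
  have hrem : Tendsto (fun N => ∑' k, (kernelOp K)^[k + N] p x) atTop (𝓝 0) :=
    ENNReal.tendsto_sum_nat_add _ hpot
  have hlim1 : Tendsto (fun N => V x + ∑ n ∈ Finset.range N, ∫⁻ ω in A n, D n ω * m (X n ω) ∂μ)
      atTop (𝓝 (V x + M)) := by
    rw [hfair]
    exact tendsto_const_nhds.add (ENNReal.tendsto_nat_tsum _)
  have hlim2 : Tendsto (fun N => M + (∑' k, (kernelOp K)^[k + N] p x + V x * ∫⁻ ω, D 1 ω ∂μ))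
      atTop (𝓝 (M + (0 + V x * ∫⁻ ω, D 1 ω ∂μ))) :=
    tendsto_const_nhds.add (hrem.add tendsto_const_nhds)
  have hle : V x + M ≤ M + (0 + V x * ∫⁻ ω, D 1 ω ∂μ) := by
    refine le_of_tendsto_of_tendsto' hlim1 hlim2 fun N => (ind N).trans ?_
    gcongr
    · exact ENNReal.sum_le_tsum _
    · rw [← h.lintegral_potential hp.measurable N]
      refine (setLIntegral_le_lintegral _ _).trans (lintegral_mono fun ω => ?_)
      dsimp only
      gcongr
      exact hVle _
    · exact hsum N
  -- Cancelling the finite common sum leaves V x ≤ V x * E[D 1], impossible for 0 < V x < ∞ since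
  -- E[D 1] < 1.
  rw [zero_add, add_comm M, ENNReal.add_le_add_iff_right hMfin] at hle
  have hVfin : V x ≠ ∞ := ne_top_of_le_ne_top hpot (hVle x)
  have : V x * ∫⁻ ω, D 1 ω ∂μ < V x * 1 := by
    exact (ENNReal.mul_lt_mul_iff_right hne hVfin).2 hD
  rw [mul_one] at this
  exact absurd hle this.not_ge

end IsDiscountedChain

end DiscountedChain

/-! ### The observed process as a discounted Markov chain -/

section Chain

variable {Ω : Type u}

/-- The paths and durations, carried to `Ω × [0, ∞)^ℕ`, where they are separate coordinates. -/
abbrev liftProcess (Y : ℝ≥0 → Ω → ℝ) (t : ℝ≥0) (p : Ω × (ℕ → ℝ≥0)) : ℝ := Y t p.1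

/-- The durations on `Ω × [0, ∞)^ℕ`. -/
abbrev liftClock (n : ℕ) (p : Ω × (ℕ → ℝ≥0)) : ℝ≥0 := p.2 n

/-- On the product space the durations can be frozen separately from the path. This is how random
observation times are reduced to deterministic ones. -/
lemma rawObsInfo_eq_comap (Y : ℝ≥0 → Ω → ℝ) (W : ℕ → Ω → ℝ≥0) (n : ℕ) :
    rawObsInfo Y W n = MeasurableSpace.comap (fun ω => (ω, fun i => W i ω))
      (rawObsInfo (liftProcess Y) liftClock n) := by
  simp only [rawObsInfo, MeasurableSpace.comap_sup, MeasurableSpace.comap_iSup,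
    MeasurableSpace.comap_comp]
  rfl

/-- With the durations frozen at `w`, the observations are values of Y at fixed times up to T_n and
the clock is constant. The Markov property at a fixed time then applies. -/
lemma comap_section_rawObsInfo_le (Y : ℝ≥0 → Ω → ℝ) (w : ℕ → ℝ≥0) (n : ℕ) :
    MeasurableSpace.comap (fun ω => (ω, w)) (rawObsInfo (liftProcess Y) liftClock n) ≤
      ⨆ r ∈ Set.Iic (∑ i ∈ Finset.range n, w i), MeasurableSpace.comap (Y r) inferInstance := by
  simp only [rawObsInfo, MeasurableSpace.comap_sup, MeasurableSpace.comap_iSup,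
    MeasurableSpace.comap_comp]
  refine sup_le (iSup₂_le fun i hi => ?_) (iSup₂_le fun i hi => ?_)
  · refine le_iSup₂_of_le (∑ j ∈ Finset.range i, w j) ?_ le_rfl
    have h := Finset.mem_range.1 hi
    exact Finset.sum_le_sum_of_subset (f := w) (Finset.range_mono (by omega : i ≤ n))
  · have : (liftClock i ∘ fun ω : Ω => (ω, w)) = fun _ => w i := rfl
    rw [this, MeasurableSpace.comap_const]
    exact bot_le

lemma rawObsInfo_lift_le_of {m : MeasurableSpace Ω} {Y : ℝ≥0 → Ω → ℝ}
    (hc : ∀ ω, IsCadlag fun t => Y t ω) (hY : ∀ t, Measurable (Y t)) (n : ℕ) :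
    rawObsInfo (liftProcess Y) liftClock n ≤
      (Prod.instMeasurableSpace : MeasurableSpace (Ω × (ℕ → ℝ≥0))) := by
  refine (rawObsInfo_le_clockInfo (Y := liftProcess Y) (W := liftClock) (fun p => hc p.1) n).trans (sup_le (iSup_le fun t => ?_)
    (iSup₂_le fun i _ => ?_))
  · have h : Measurable fun p : Ω × (ℕ → ℝ≥0) => Y t p.1 := (hY t).comp measurable_fst
    exact h.comap_le
  · have h : Measurable fun p : Ω × (ℕ → ℝ≥0) => p.2 i :=
      (measurable_pi_apply i).comp measurable_snd
    exact h.comap_le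

lemma rawObsInfo_lift_le {Y : ℝ≥0 → Ω → ℝ} (hc : ∀ ω, IsCadlag fun t => Y t ω) (n : ℕ) :
    rawObsInfo (liftProcess Y) liftClock n ≤ (pathInfo Y).prod MeasurableSpace.pi :=
  @rawObsInfo_lift_le_of Ω (pathInfo Y) Y hc (measurable_pathInfo Y) n

/-- The discount factor `e^{-q T_n}`. -/
def obsDiscount (q : ℝ) (W : ℕ → Ω → ℝ≥0) (n : ℕ) (ω : Ω) : ℝ≥0∞ :=
  ENNReal.ofReal (Real.exp (-q * obsTime W n ω))

lemma obsTime_succ (W : ℕ → Ω → ℝ≥0) (n : ℕ) (ω : Ω) :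
    obsTime W (n + 1) ω = obsTime W n ω + W n ω := Finset.sum_range_succ _ _

lemma obsDiscount_succ (q : ℝ) (W : ℕ → Ω → ℝ≥0) (n : ℕ) (ω : Ω) :
    obsDiscount q W (n + 1) ω =
      obsDiscount q W n ω * ENNReal.ofReal (Real.exp (-q * W n ω)) := by
  rw [obsDiscount, obsDiscount, ← ENNReal.ofReal_mul (Real.exp_nonneg _), ← Real.exp_add,
    obsTime_succ]
  push_cast
  ring_nf

lemma measurable_obsDiscount_of {m : MeasurableSpace Ω} (q : ℝ) {W : ℕ → Ω → ℝ≥0} {n : ℕ}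
    (h : Measurable (obsTime W n)) : Measurable (obsDiscount q W n) :=
  (measurable_discount q).comp h

variable [mΩ : MeasurableSpace Ω] {P : ℝ → Measure Ω} {Y : ℝ≥0 → Ω → ℝ} {W : ℕ → Ω → ℝ≥0} {l : ℝ}

/-- The Markov property at a fixed time, for nonnegative functions. -/
lemma IsCadlagMarkovProcess.setLIntegral_add (hY : IsCadlagMarkovProcess P Y) (x : ℝ) (t s : ℝ≥0)
    {B : Set Ω} (hB : MeasurableSet[⨆ r ∈ Set.Iic t, MeasurableSpace.comap (Y r) inferInstance] B)
    {f : ℝ → ℝ≥0∞} (hf : Measurable f) :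
    ∫⁻ ω in B, f (Y (t + s) ω) ∂(P x) =
      ∫⁻ ω in B, ∫⁻ z, f z ∂(hY.kernel (s, Y t ω)) ∂(P x) := by
  have := hY.isProbabilityMeasure
  have hm : (⨆ r ∈ Set.Iic t, MeasurableSpace.comap (Y r) inferInstance) ≤ mΩ := iSup₂_le fun r _ => (hY.measurable r).comap_le
  have hκ : Measurable fun ω => hY.kernel (s, Y t ω) :=
    hY.kernel.measurable.comp (measurable_const.prodMk (hY.measurable t))
  -- The conditional Markov property on sets becomes an identity of measures, from which all
  -- nonnegative measurable f follow at once.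
  have key : ((P x).restrict B).map (Y (t + s)) =
      ((P x).restrict B).bind fun ω => hY.kernel (s, Y t ω) := by
    ext A hA
    rw [Measure.map_apply (hY.measurable _) hA, Measure.bind_apply hA hκ.aemeasurable]
    have hAm : MeasurableSet (Y (t + s) ⁻¹' A) := hY.measurable _ hA
    have h1 := setIntegral_condExp (μ := P x) hm
      (f := (Y (t + s) ⁻¹' A).indicator (fun _ => (1 : ℝ)))
      ((integrable_const 1).indicator hAm) hB
    rw [setIntegral_congr_ae (hm _ hB) ((hY.markov x t s A hA).mono fun ω h _ => h),
      integral_indicator_const _ hAm] at h1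
    have hmeas : Measurable fun ω => P (Y t ω) (Y s ⁻¹' A) :=
      (hY.measurable_transition s A hA).comp (hY.measurable t)
    simp only [Measure.real, smul_eq_mul, mul_one] at h1
    rw [integral_toReal hmeas.aemeasurable
      (Eventually.of_forall fun ω => measure_lt_top _ _)] at h1
    have h2 : ∫⁻ ω in B, P (Y t ω) (Y s ⁻¹' A) ∂(P x) ≠ ∞ := by
      refine ne_top_of_le_ne_top (b := ∫⁻ ω in B, 1 ∂(P x)) (by simp)
        (lintegral_mono fun ω => prob_le_one)
    rw [ENNReal.toReal_eq_toReal_iff' h2 (measure_ne_top _ _)] at h1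
    rw [← h1]
    refine lintegral_congr fun ω => ?_
    rw [hY.kernel_apply, Measure.map_apply (hY.measurable s) hA]
  rw [← lintegral_map hf (hY.measurable _), key, Measure.lintegral_bind hκ.aemeasurable
    hf.aemeasurable]

/-- The Markov property at an observation time. -/
lemma setLIntegral_obsTime_add (hY : IsCadlagMarkovProcess P Y) (hW : IsExponentialClock P Y W l)
    (x : ℝ) (n : ℕ) (s : ℝ≥0) {A : Set Ω} (hA : MeasurableSet[rawObsInfo Y W n] A)
    {c : ℝ≥0 → ℝ≥0∞} (hc : Measurable c) {f : ℝ → ℝ≥0∞} (hf : Measurable f) :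
    ∫⁻ ω in A, c (obsTime W n ω) * f (Y (obsTime W n ω + s) ω) ∂(P x) =
      ∫⁻ ω in A, c (obsTime W n ω) * ∫⁻ z, f z ∂(hY.kernel (s, obsState Y W n ω)) ∂(P x) := by
  have := hY.isProbabilityMeasure
  have hAm : MeasurableSet A :=
    clockInfo_le hY hW n _ (rawObsInfo_le_clockInfo hY.cadlag n _ hA)
  rw [rawObsInfo_eq_comap] at hA
  obtain ⟨A', hA', rfl⟩ := hA
  have hA'm : MeasurableSet[(pathInfo Y).prod MeasurableSpace.pi] A' :=
    rawObsInfo_lift_le hY.cadlag n _ hA'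
  have hWm : Measurable fun ω i => W i ω := measurable_pi_lambda _ hW.measurable
  have : IsProbabilityMeasure ((P x).map fun ω i => W i ω) :=
    Measure.isProbabilityMeasure_map hWm.aemeasurable
  let T : (ℕ → ℝ≥0) → ℝ≥0 := fun w => ∑ i ∈ Finset.range n, w i
  have hT : Measurable T := Finset.measurable_fun_sum _ fun i _ => measurable_pi_apply i
  have hjoint : Measurable[(pathInfo Y).prod inferInstance] fun p : Ω × ℝ≥0 => Y p.2 p.1 :=
    @measurable_uncurry_of_rightContinuous Ω (pathInfo Y) Y (measurable_pathInfo Y)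
      fun ω => (hY.cadlag ω).1
  have hle : (pathInfo Y).prod MeasurableSpace.pi ≤
      (Prod.instMeasurableSpace : MeasurableSpace (Ω × (ℕ → ℝ≥0))) :=
    sup_le_sup (MeasurableSpace.comap_mono hY.pathInfo_le) le_rfl
  let mp : MeasurableSpace (Ω × (ℕ → ℝ≥0)) := (pathInfo Y).prod MeasurableSpace.pi
  have hYT (s : ℝ≥0) : Measurable[mp] fun p : Ω × (ℕ → ℝ≥0) => Y (T p.2 + s) p.1 := by
    have h2 : Measurable[mp, (pathInfo Y).prod inferInstance]
        fun p : Ω × (ℕ → ℝ≥0) => (p.1, T p.2 + s) :=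
      (@measurable_fst Ω (ℕ → ℝ≥0) (pathInfo Y) _).prodMk
        ((hT.comp (@measurable_snd Ω (ℕ → ℝ≥0) (pathInfo Y) _)).add_const s)
    exact hjoint.comp h2
  have hcT : Measurable[mp] fun p : Ω × (ℕ → ℝ≥0) => c (T p.2) :=
    hc.comp (hT.comp (@measurable_snd Ω (ℕ → ℝ≥0) (pathInfo Y) _))
  -- The clock is independent of the path, so by Tonelli the durations can be integrated last, the
  -- path being averaged for each fixed sequence `w`.
  have swap (G : Ω × (ℕ → ℝ≥0) → ℝ≥0∞) (hG : Measurable[mp] G) :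
      ∫⁻ ω in (fun ω => (ω, fun i => W i ω)) ⁻¹' A', c (obsTime W n ω) * G (ω, fun i => W i ω)
        ∂(P x) = ∫⁻ w, c (T w) * ∫⁻ ω in (fun ω => (ω, w)) ⁻¹' A', G (ω, w) ∂(P x)
          ∂((P x).map fun ω i => W i ω) := by
    have hF : Measurable[mp] (A'.indicator fun p => c (T p.2) * G p) :=
      (hcT.mul hG).indicator hA'm
    have h1 := lintegral_comp_of_indep hY.pathInfo_le hWm (indep_pathInfo_clock hW x) hF
    rw [lintegral_lintegral_swap (f := fun ω w => A'.indicator (fun p => c (T p.2) * G p) (ω, w))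
      (hF.mono hle le_rfl).aemeasurable] at h1
    rw [← lintegral_indicator hAm]
    refine Eq.trans ?_ (h1.trans ?_)
    · rfl
    · refine lintegral_congr fun w => ?_
      have hGw : Measurable fun ω => G (ω, w) := (hG.mono hle le_rfl).comp measurable_prodMk_right
      rw [← lintegral_const_mul _ hGw, ← lintegral_indicator
        ((measurable_prodMk_right (y := w)) (hle _ hA'm))]
      rfl
  have hκ : Measurable[mp] fun p : Ω × (ℕ → ℝ≥0) => ∫⁻ z, f z ∂(hY.kernel (s, Y (T p.2) p.1)) := by
    have h3 : Measurable fun y => ∫⁻ z, f z ∂(hY.kernel (s, y)) :=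
      (hf.lintegral_kernel (κ := hY.kernel)).comp (measurable_const.prodMk measurable_id)
    have h4 := hYT 0
    simp only [add_zero] at h4
    exact h3.comp h4
  have e1 := swap (fun p => f (Y (T p.2 + s) p.1)) (hf.comp (hYT s))
  have e2 := swap _ hκ
  refine e1.trans (Eq.trans ?_ e2.symm)
  refine lintegral_congr fun w => ?_
  congr 1
  refine hY.setLIntegral_add x (T w) s ?_ hf
  exact comap_section_rawObsInfo_le Y w n _ ⟨A', hA', rfl⟩

/-- One step of the observed chain. -/
lemma setLIntegral_obsDiscount_succ (hY : IsCadlagMarkovProcess P Y)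
    (hW : IsExponentialClock P Y W l) (q : ℝ) (hl : 0 < l) (x : ℝ) (n : ℕ) {A : Set Ω}
    (hA : MeasurableSet[rawObsInfo Y W n] A) {f : ℝ → ℝ≥0∞} (hf : Measurable f) :
    ∫⁻ ω in A, obsDiscount q W (n + 1) ω * f (obsState Y W (n + 1) ω) ∂(P x) =
      ∫⁻ ω in A, obsDiscount q W n ω * kernelOp (discountedKernel hY q l) f (obsState Y W n ω)
        ∂(P x) := by
  have := hY.isProbabilityMeasure x
  have := isProbabilityMeasure_clockLaw hl
  have hAH : MeasurableSet[clockInfo Y W n] A := rawObsInfo_le_clockInfo hY.cadlag n _ hA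
  have hAm : MeasurableSet A := clockInfo_le hY hW n _ hAH
  have hle : (clockInfo Y W n).prod inferInstance ≤
      (Prod.instMeasurableSpace : MeasurableSpace (Ω × ℝ≥0)) :=
    sup_le_sup (MeasurableSpace.comap_mono (clockInfo_le hY hW n)) le_rfl
  have hTH : Measurable[clockInfo Y W n] (obsTime W n) :=
    (measurable_obsTime_raw Y W n).mono (rawObsInfo_le_clockInfo hY.cadlag n) le_rfl
  let e : ℝ≥0 → ℝ≥0∞ := fun t => ENNReal.ofReal (Real.exp (-q * t))
  have he : Measurable e := measurable_discount q
  have hshift : Measurable[(clockInfo Y W n).prod inferInstance]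
      fun p : Ω × ℝ≥0 => Y (obsTime W n p.1 + p.2) p.1 :=
    @measurable_shift_of Ω (clockInfo Y W n) Y hY.cadlag
      (fun t => (measurable_pathInfo Y t).mono le_sup_left le_rfl) _ hTH
  let G : Ω × ℝ≥0 → ℝ≥0∞ := fun p =>
    obsDiscount q W n p.1 * (e p.2 * f (Y (obsTime W n p.1 + p.2) p.1))
  have hG : Measurable[(clockInfo Y W n).prod inferInstance] G :=
    ((@measurable_obsDiscount_of Ω (clockInfo Y W n) q W n hTH).comp
      (@measurable_fst Ω ℝ≥0 (clockInfo Y W n) _)).mul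
      ((he.comp (@measurable_snd Ω ℝ≥0 (clockInfo Y W n) _)).mul (hf.comp hshift))
  have hpre : MeasurableSet[(clockInfo Y W n).prod inferInstance] (Prod.fst ⁻¹' A : Set (Ω × ℝ≥0)) :=
    (@measurable_fst Ω ℝ≥0 (clockInfo Y W n) _) hAH
  -- Integrating out W_n first leaves a deterministic delay t after T_n, for which the Markov
  -- property at an observation time is available.
  have h1 := lintegral_comp_clock hY hW x n (hG.indicator hpre)
  rw [lintegral_lintegral_swap
    (f := fun ω t => (Prod.fst ⁻¹' A : Set (Ω × ℝ≥0)).indicator G (ω, t)) ((hG.indicator hpre).mono hle le_rfl).aemeasurable] at h1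
  have hX : Measurable (obsState Y W n) := measurable_obsState_of hY.cadlag hY.measurable
    fun i _ => hW.measurable i
  have hD : Measurable (obsDiscount q W n) := hTH.mono (clockInfo_le hY hW n) le_rfl |>
    measurable_obsDiscount_of q
  have hκ : Measurable fun p : ℝ≥0 × Ω => ∫⁻ z, f z ∂(hY.kernel (p.1, obsState Y W n p.2)) :=
    (hf.lintegral_kernel (κ := hY.kernel)).comp
      (measurable_fst.prodMk (hX.comp measurable_snd))
  calc ∫⁻ ω in A, obsDiscount q W (n + 1) ω * f (obsState Y W (n + 1) ω) ∂(P x)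
      = ∫⁻ ω, (Prod.fst ⁻¹' A : Set (Ω × ℝ≥0)).indicator G (ω, W n ω) ∂(P x) := by
        rw [← lintegral_indicator hAm]
        refine lintegral_congr fun ω => ?_
        by_cases hω : ω ∈ A
        · rw [Set.indicator_of_mem hω, Set.indicator_of_mem (by exact hω)]
          simp only [G, e, obsDiscount_succ, obsState, obsTime_succ, mul_assoc]
        · rw [Set.indicator_of_notMem hω, Set.indicator_of_notMem (by exact hω)]
    _ = ∫⁻ t, ∫⁻ ω, (Prod.fst ⁻¹' A : Set (Ω × ℝ≥0)).indicator G (ω, t) ∂(P x) ∂(clockLaw l) := h1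
    _ = ∫⁻ t, ∫⁻ ω in A, e t * (obsDiscount q W n ω *
          ∫⁻ z, f z ∂(hY.kernel (t, obsState Y W n ω))) ∂(P x) ∂(clockLaw l) := by
        refine lintegral_congr fun t => ?_
        have h2 := setLIntegral_obsTime_add hY hW x n t hA (measurable_discount q) hf
        have hκt : Measurable fun ω => ∫⁻ z, f z ∂(hY.kernel (t, obsState Y W n ω)) :=
          hκ.comp measurable_prodMk_left
        refine Eq.trans ?_ ((congrArg (e t * ·) h2).trans
          (lintegral_const_mul _ (hD.mul hκt)).symm)
        rw [← lintegral_const_mul, ← lintegral_indicator hAm]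
        · refine lintegral_congr fun ω => ?_
          by_cases hω : ω ∈ A
          · rw [Set.indicator_of_mem hω, Set.indicator_of_mem (by exact hω)]
            simp only [G, obsDiscount]
            ring
          · rw [Set.indicator_of_notMem hω, Set.indicator_of_notMem (by exact hω)]
        · exact hD.mul (hf.comp ((hshift.mono hle le_rfl).comp measurable_prodMk_right))
    _ = ∫⁻ ω in A, ∫⁻ t, e t * (obsDiscount q W n ω *
          ∫⁻ z, f z ∂(hY.kernel (t, obsState Y W n ω))) ∂(clockLaw l) ∂(P x) := by
        refine lintegral_lintegral_swap (Measurable.aemeasurable ?_)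
        exact (he.comp measurable_fst).mul ((hD.comp measurable_snd).mul hκ)
    _ = _ := by
        refine lintegral_congr fun ω => ?_
        rw [kernelOp, lintegral_discountedKernel hY q hl hf, ← lintegral_const_mul]
        · refine lintegral_congr fun t => ?_
          simp only [e]
          ring
        · exact he.mul (hκ.comp measurable_prodMk_right)

lemma isDiscountedChain_obs (hY : IsCadlagMarkovProcess P Y) (hW : IsExponentialClock P Y W l)
    {q : ℝ} (hq : 0 < q) (hl : 0 < l) (x : ℝ) :
    IsDiscountedChain (P x) (discountedKernel hY q l) (rawObsInfo Y W) (obsDiscount q W)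
      (obsState Y W) x where
  le n := (rawObsInfo_le_clockInfo hY.cadlag n).trans (clockInfo_le hY hW n)
  mono := monotone_rawObsInfo Y W
  measurable_state := measurable_obsState_raw Y W
  measurable_discount n := measurable_obsDiscount_of q (measurable_obsTime_raw Y W n)
  antitone ω := antitone_nat_of_succ_le fun n => by
    rw [obsDiscount_succ]
    refine mul_le_of_le_one_right' ?_
    rw [ENNReal.ofReal_le_one, Real.exp_le_one_iff]
    have : 0 ≤ q * W n ω := by positivity
    linarith
  discount_zero ω := by simp [obsDiscount, obsTime]
  start := by
    filter_upwards [hY.start x] with ω hω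
    simpa [obsState, obsTime] using hω
  step n A hA f hf := setLIntegral_obsDiscount_succ hY hW q hl x n hA hf

/-- Compare f(Y(t)) pathwise under the coupling, then transfer each expectation back to the original
law. -/
lemma IsOrderPreserving.monotone_lintegral (hord : IsOrderPreserving P Y)
    (t : ℝ≥0) {f : ℝ → ℝ≥0∞} (hf : Monotone f) :
    Monotone fun y => ∫⁻ ω, f (Y t ω) ∂(P y) := by
  refine monotone_iff_forall_lt.2 fun y z hyz => ?_
  obtain ⟨Ω', _, Q, Yx, Yy, _, h1, h2, h3⟩ := hord y z hyz
  have hg : Measurable fun p : ℝ≥0 → ℝ => f (p t) := hf.measurable.comp (measurable_pi_apply t)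
  have e1 := (h1.comp hg).lintegral_eq
  have e2 := (h2.comp hg).lintegral_eq
  refine e1.symm.le.trans (le_trans ?_ e2.le)
  refine lintegral_mono_ae ?_
  filter_upwards [h3] with ω hω
  exact hf (hω t)

lemma monotone_kernelOp_discountedKernel (hord : IsOrderPreserving P Y)
    (hY : IsCadlagMarkovProcess P Y) (q : ℝ) (hl : 0 < l) (f : ℝ → ℝ≥0∞) (hf : Monotone f) :
    Monotone (kernelOp (discountedKernel hY q l) f) := by
  intro y z hyz
  rw [kernelOp, kernelOp, lintegral_discountedKernel hY q hl hf.measurable,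
    lintegral_discountedKernel hY q hl hf.measurable]
  refine lintegral_mono fun t => ?_
  simp only [hY.lintegral_kernel hf.measurable]
  exact mul_le_mul_right (hord.monotone_lintegral t hf hyz) _

end Chain

/-! ### Excursion integrals as sums over observation times -/

section Excursion

section ClockLaw

lemma lintegral_clockLaw {l : ℝ} {f : ℝ≥0 → ℝ≥0∞} (hf : Measurable f) :
    ∫⁻ t, f t ∂(clockLaw l) =
      ∫⁻ u in Set.Ioi (0 : ℝ), ENNReal.ofReal (l * Real.exp (-(l * u))) * f u.toNNReal := by
  have hpdf : Measurable (exponentialPDF l) :=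
    (measurable_exponentialPDFReal l).ennreal_ofReal
  have hfu : Measurable fun u : ℝ => f u.toNNReal := hf.comp measurable_real_toNNReal
  have h : expMeasure l = volume.withDensity (exponentialPDF l) := rfl
  rw [clockLaw, lintegral_map hf measurable_real_toNNReal, h,
    lintegral_withDensity_eq_lintegral_mul _ hpdf hfu,
    ← setLIntegral_eq_of_support_subset (s := Set.Ici 0), setLIntegral_congr Ioi_ae_eq_Ici.symm]
  · refine setLIntegral_congr_fun measurableSet_Ioi fun u hu => ?_
    rw [Pi.mul_apply, exponentialPDF_of_nonneg (le_of_lt hu)]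
  · intro u hu
    by_contra hneg
    rw [Set.mem_Ici, not_le] at hneg
    exact hu (by rw [Pi.mul_apply, exponentialPDF_of_neg hneg, zero_mul])

lemma ae_clockLaw_pos (l : ℝ) : ∀ᵐ t ∂(clockLaw l), 0 < t := by
  have h : clockLaw l {0} = 0 := by
    rw [← lintegral_indicator_one (measurableSet_singleton 0),
      lintegral_clockLaw (measurable_one.indicator (measurableSet_singleton 0)),
      setLIntegral_congr_fun (g := fun _ => 0) measurableSet_Ioi]
    · simp
    · intro u hu
      have : u.toNNReal ∉ ({0} : Set ℝ≥0) := by simpa using hu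
      simp only [Set.indicator_of_notMem this, mul_zero]
  filter_upwards [compl_mem_ae_iff.2 h] with t ht
  exact pos_iff_ne_zero.2 ht

/-- The strict inequality, due to W > 0 almost surely, is what closes the contradiction in
`stoppingValue_eq_zero`. -/
lemma lintegral_discount_lt_one {q l : ℝ} (hq : 0 < q) (hl : 0 < l) :
    ∫⁻ t, ENNReal.ofReal (Real.exp (-q * t)) ∂(clockLaw l) < 1 := by
  have := isProbabilityMeasure_clockLaw hl
  have hle : ∀ t : ℝ≥0, ENNReal.ofReal (Real.exp (-q * t)) ≤ 1 := fun t => by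
    rw [ENNReal.ofReal_le_one, Real.exp_le_one_iff]
    have : 0 ≤ q * t := by positivity
    linarith
  have h1 : ∫⁻ _ : ℝ≥0, 1 ∂(clockLaw l) = 1 := by simp
  calc _ < ∫⁻ _ : ℝ≥0, 1 ∂(clockLaw l) := by
        refine lintegral_strict_mono (IsProbabilityMeasure.ne_zero _) aemeasurable_const ?_ ?_
        · exact ne_top_of_le_ne_top (by rw [h1]; simp) (lintegral_mono hle)
        · filter_upwards [ae_clockLaw_pos l] with t ht
          rw [ENNReal.ofReal_lt_one, Real.exp_lt_one_iff]
          have : 0 < q * t := by positivity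
          linarith
    _ = 1 := h1

lemma clockLaw_Ioi {l : ℝ} (hl : 0 < l) {u : ℝ} (hu : 0 < u) :
    clockLaw l {t | u < t} = ENNReal.ofReal (Real.exp (-(l * u))) := by
  have hs : MeasurableSet {t : ℝ≥0 | u < t} := measurableSet_lt measurable_const
    measurable_coe_nnreal_real
  have := isProbabilityMeasure_expMeasure hl
  have h : Real.toNNReal ⁻¹' {t : ℝ≥0 | u < t} = (Set.Iic u)ᶜ := by
    ext z
    simp only [Set.mem_preimage, Set.mem_ofPred_eq, Set.mem_compl_iff, Set.mem_Iic, not_le,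
      Real.coe_toNNReal', lt_max_iff]
    exact ⟨fun h => h.resolve_right (by linarith), Or.inl⟩
  rw [clockLaw, Measure.map_apply measurable_real_toNNReal hs, h,
    prob_compl_eq_one_sub measurableSet_Iic, ← ofReal_cdf, cdf_expMeasure_eq hl, if_pos hu.le,
    ← ENNReal.ofReal_one, ← ENNReal.ofReal_sub]
  · congr 1
    ring
  · rw [sub_nonneg, Real.exp_le_one_iff]
    have : 0 ≤ l * u := by positivity
    linarith

/-- The time spent before an exponential time, weighted by `ψ`, has mean `E[ψ(W)] / l`. -/
lemma lintegral_clockLaw_setLIntegral {l : ℝ} (hl : 0 < l) {ψ : ℝ≥0 → ℝ≥0∞} (hψ : Measurable ψ) :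
    ENNReal.ofReal l * ∫⁻ t : ℝ≥0, (∫⁻ u in Set.Ioo (0 : ℝ) t, ψ u.toNNReal) ∂(clockLaw l) =
      ∫⁻ t, ψ t ∂(clockLaw l) := by
  have := isProbabilityMeasure_clockLaw hl
  have hψu : Measurable fun u : ℝ => ψ u.toNNReal := hψ.comp measurable_real_toNNReal
  have hset : MeasurableSet {p : ℝ≥0 × ℝ | p.2 < p.1} :=
    measurableSet_lt measurable_snd (measurable_coe_nnreal_real.comp measurable_fst)
  have h1 (t : ℝ≥0) : ∫⁻ u in Set.Ioo (0 : ℝ) t, ψ u.toNNReal =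
      ∫⁻ u in Set.Ioi (0 : ℝ), {p : ℝ≥0 × ℝ | p.2 < p.1}.indicator
        (fun p => ψ p.2.toNNReal) (t, u) := by
    have : Set.Ioo (0 : ℝ) t = Set.Iio (t : ℝ) ∩ Set.Ioi 0 := by
      rw [Set.inter_comm, Set.Ioi_inter_Iio]
    rw [this, ← Measure.restrict_restrict measurableSet_Iio,
      ← lintegral_indicator measurableSet_Iio]
    rfl
  -- After Tonelli the inner integral is the tail P(W > u) = e^{-l u}, and l times it is the
  -- exponential density.
  simp_rw [h1]
  rw [lintegral_lintegral_swap (f := fun (t : ℝ≥0) (u : ℝ) => {p : ℝ≥0 × ℝ | p.2 < p.1}.indicator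
    (fun p => ψ p.2.toNNReal) (t, u)) ((hψu.comp measurable_snd).indicator hset).aemeasurable,
    lintegral_clockLaw hψ, ← lintegral_const_mul' _ _ ENNReal.ofReal_ne_top]
  refine setLIntegral_congr_fun measurableSet_Ioi fun u hu => ?_
  have h2 : ∫⁻ t : ℝ≥0, {p : ℝ≥0 × ℝ | p.2 < p.1}.indicator (fun p => ψ p.2.toNNReal) (t, u)
      ∂(clockLaw l) = ψ u.toNNReal * clockLaw l {t | u < t} := by
    rw [← lintegral_indicator_const (measurableSet_lt measurable_const measurable_coe_nnreal_real)]
    rfl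
  rw [h2, clockLaw_Ioi hl hu, ENNReal.ofReal_mul hl.le]
  ring

end ClockLaw

section Pathwise

variable {Ω : Type u} {Y : ℝ≥0 → Ω → ℝ} {W : ℕ → Ω → ℝ≥0} {x : ℝ} {ω : Ω}

lemma monotone_obsTime (W : ℕ → Ω → ℝ≥0) (ω : Ω) : Monotone fun n => obsTime W n ω :=
  monotone_nat_of_le_succ fun n => by rw [obsTime_succ]; exact le_self_add

lemma obsTime_pos (h0 : 0 < W 0 ω) {n : ℕ} (hn : 0 < n) : 0 < obsTime W n ω := by
  have h1 : obsTime W 1 ω = W 0 ω := by simp [obsTime]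
  exact (h1 ▸ h0).trans_le (monotone_obsTime W ω hn)

lemma coe_obsTime_le_firstObsBelow {n : ℕ} (h : (n : ℕ∞) < firstStepBelow (obsState Y W) x ω) :
    (obsTime W (n + 1) ω : ℝ≥0∞) ≤ firstObsBelow Y W x ω := by
  refine le_sInf ?_
  rintro _ ⟨k, rfl, hk, hkx⟩
  have hk0 : 0 < k := by
    by_contra! hk0
    obtain rfl : k = 0 := by omega
    simp [obsTime] at hk
  have : n < k := by
    by_contra! hkn
    exact absurd (lt_firstStepBelow_iff.1 h k hk0 hkn) hkx.not_gt
  exact_mod_cast monotone_obsTime W ω (by omega : n + 1 ≤ k)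

/-- T_x^- asks for T_n > 0 whereas the step count asks for n > 0; W_0 > 0 makes the two agree. -/
lemma firstObsBelow_le_coe_obsTime (h0 : 0 < W 0 ω) {n : ℕ}
    (h : ¬ (n : ℕ∞) < firstStepBelow (obsState Y W) x ω) :
    firstObsBelow Y W x ω ≤ (obsTime W n ω : ℝ≥0∞) := by
  rw [lt_firstStepBelow_iff] at h
  push Not at h
  obtain ⟨k, hk, hkn, hkx⟩ := h
  have hmem : firstObsBelow Y W x ω ≤ (obsTime W k ω : ℝ≥0∞) :=
    sInf_le ⟨k, rfl, by exact_mod_cast obsTime_pos h0 hk, hkx⟩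
  refine hmem.trans ?_
  exact_mod_cast monotone_obsTime W ω hkn

/-- Since T_n → ∞, the intervals between observations cover [0, ∞) up to the countable set of
observation times, and T_x^- is an end point of one of them or infinite. -/
lemma timesBefore_ae_eq (h0 : 0 < W 0 ω) (hinf : ∀ s : ℝ≥0, ∃ n, s < obsTime W n ω) :
    timesBefore Y W x ω =ᵐ[volume] ⋃ n : ℕ, if (n : ℕ∞) < firstStepBelow (obsState Y W) x ω then
      Set.Ioo (obsTime W n ω : ℝ) (obsTime W (n + 1) ω) else ∅ := by
  have hc : volume (Set.range fun n => (obsTime W n ω : ℝ)) = 0 :=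
    (Set.countable_range _).measure_zero _
  filter_upwards [compl_mem_ae_iff.2 hc] with s hs
  refine propext ?_
  change s ∈ timesBefore Y W x ω ↔ s ∈ ⋃ _, _
  simp only [Set.mem_iUnion]
  constructor
  · rintro ⟨hs0, hsT⟩
    classical
    -- The first observation after s has index n + 1, since T_0 = 0 is not after s; so s lies
    -- between T_n and T_{n+1}.
    have hex := hinf s.toNNReal
    obtain ⟨n, hn⟩ : ∃ n, Nat.find hex = n + 1 := Nat.exists_eq_succ_of_ne_zero fun h => by
      have := Nat.find_spec hex
      rw [h] at this
      simp [obsTime] at this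
    have h1 := Nat.find_spec hex
    rw [hn] at h1
    have h2 : obsTime W n ω ≤ s.toNNReal := not_lt.1 (Nat.find_min hex (by omega))
    refine ⟨n, ?_⟩
    rw [if_pos]
    · have h3 : (obsTime W n ω : ℝ) ≤ s := by
        rw [← Real.coe_toNNReal s hs0.le]
        exact_mod_cast h2
      have h4 : s < (obsTime W (n + 1) ω : ℝ) := by
        rw [← Real.coe_toNNReal s hs0.le]
        exact_mod_cast h1
      exact ⟨lt_of_le_of_ne h3 fun h => hs ⟨n, h⟩, h4⟩
    · by_contra h
      have := hsT.trans_le (firstObsBelow_le_coe_obsTime h0 h)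
      have : s.toNNReal < obsTime W n ω := ENNReal.coe_lt_coe.1 this
      exact absurd h2 this.not_ge
  · rintro ⟨n, hn⟩
    split_ifs at hn with h
    · have hs0 : 0 < s := lt_of_le_of_lt (NNReal.coe_nonneg _) hn.1
      refine ⟨hs0, lt_of_lt_of_le ?_ (coe_obsTime_le_firstObsBelow h)⟩
      rw [← ENNReal.ofReal_coe_nnreal]
      exact (ENNReal.ofReal_lt_ofReal_iff (hs0.trans hn.2)).2 hn.2
    · exact absurd hn (Set.notMem_empty _)

lemma setLIntegral_Ioo_add (φ : ℝ≥0 → ℝ≥0∞) (a b : ℝ≥0) :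
    ∫⁻ s in Set.Ioo (a : ℝ) ((a + b : ℝ≥0) : ℝ), φ s.toNNReal =
      ∫⁻ u in Set.Ioo (0 : ℝ) b, φ (a + u.toNNReal) := by
  rw [← lintegral_indicator measurableSet_Ioo, ← lintegral_add_left_eq_self _ (a : ℝ),
    ← lintegral_indicator measurableSet_Ioo]
  refine lintegral_congr fun u => ?_
  by_cases hu : u ∈ Set.Ioo (0 : ℝ) b
  · have hu' : (a : ℝ) + u ∈ Set.Ioo (a : ℝ) ((a + b : ℝ≥0) : ℝ) := by
      push_cast
      exact ⟨by linarith [hu.1], by linarith [hu.2]⟩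
    rw [Set.indicator_of_mem hu, Set.indicator_of_mem hu', Real.toNNReal_add a.coe_nonneg hu.1.le,
      Real.toNNReal_coe]
  · have hu' : (a : ℝ) + u ∉ Set.Ioo (a : ℝ) ((a + b : ℝ≥0) : ℝ) := by
      push_cast
      exact fun h => hu ⟨by linarith [h.1], by linarith [h.2]⟩
    rw [Set.indicator_of_notMem hu, Set.indicator_of_notMem hu']

lemma setLIntegral_timesBefore (h0 : 0 < W 0 ω) (hinf : ∀ s : ℝ≥0, ∃ n, s < obsTime W n ω)
    (φ : ℝ≥0 → ℝ≥0∞) :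
    ∫⁻ s in timesBefore Y W x ω, φ s.toNNReal =
      ∑' n : ℕ, {ω | (n : ℕ∞) < firstStepBelow (obsState Y W) x ω}.indicator
        (fun ω => ∫⁻ u in Set.Ioo (0 : ℝ) (W n ω), φ (obsTime W n ω + u.toNNReal)) ω := by
  rw [setLIntegral_congr (timesBefore_ae_eq h0 hinf), lintegral_iUnion]
  · refine tsum_congr fun n => ?_
    by_cases h : (n : ℕ∞) < firstStepBelow (obsState Y W) x ω
    · rw [if_pos h, Set.indicator_of_mem (by exact h), obsTime_succ, setLIntegral_Ioo_add]
    · rw [if_neg h, Set.indicator_of_notMem (by exact h), Measure.restrict_empty,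
        lintegral_zero_measure]
  · intro n
    split_ifs
    · exact measurableSet_Ioo
    · exact MeasurableSet.empty
  · have hmono : Monotone fun n => (obsTime W n ω : ℝ) := fun i j hij => by
      exact_mod_cast monotone_obsTime W ω hij
    intro i j hij
    refine Disjoint.mono ?_ ?_ (hmono.pairwise_disjoint_on_Ioo_succ hij) <;>
    · dsimp only
      split_ifs
      · exact le_rfl
      · exact Set.empty_subset _

end Pathwise

lemma measurable_setLIntegral_Ioo {α : Type*} [MeasurableSpace α] {φ : α × ℝ≥0 → ℝ≥0∞}
    (hφ : Measurable φ) :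
    Measurable fun p : α × ℝ≥0 => ∫⁻ u in Set.Ioo (0 : ℝ) p.2, φ (p.1, u.toNNReal) := by
  have hset : MeasurableSet {z : (α × ℝ≥0) × ℝ | z.2 ∈ Set.Ioo (0 : ℝ) z.1.2} :=
    (measurableSet_lt measurable_const measurable_snd).inter (measurableSet_lt measurable_snd
      (measurable_coe_nnreal_real.comp (measurable_snd.comp measurable_fst)))
  have hz : Measurable fun z : (α × ℝ≥0) × ℝ => φ (z.1.1, z.2.toNNReal) :=
    hφ.comp ((measurable_fst.comp measurable_fst).prodMk
      (measurable_real_toNNReal.comp measurable_snd))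
  have h := (hz.indicator hset).lintegral_prod_right' (ν := volume)
  have heq : (fun p : α × ℝ≥0 => ∫⁻ u in Set.Ioo (0 : ℝ) p.2, φ (p.1, u.toNNReal)) =
      fun p => ∫⁻ u, {z : (α × ℝ≥0) × ℝ | z.2 ∈ Set.Ioo (0 : ℝ) z.1.2}.indicator
        (fun z => φ (z.1.1, z.2.toNNReal)) (p, u) := by
    ext p
    rw [← lintegral_indicator measurableSet_Ioo]
    rfl
  rw [heq]
  exact h

lemma measurable_discounted_shift {Ω : Type u} {m : MeasurableSpace Ω} {Y : ℝ≥0 → Ω → ℝ}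
    (hc : ∀ ω, IsCadlag fun t => Y t ω) (hY : ∀ t, Measurable (Y t)) {T : Ω → ℝ≥0}
    (hT : Measurable T) (q : ℝ) {f : ℝ → ℝ≥0∞} (hf : Measurable f) :
    Measurable fun p : Ω × ℝ≥0 =>
      ENNReal.ofReal (Real.exp (-q * (T p.1 + p.2 : ℝ≥0))) * f (Y (T p.1 + p.2) p.1) :=
  ((measurable_discount q).comp ((hT.comp measurable_fst).add measurable_snd)).mul
    (hf.comp (measurable_shift_of hc hY hT))

variable {Ω : Type u} [mΩ : MeasurableSpace Ω] {P : ℝ → Measure Ω} {Y : ℝ≥0 → Ω → ℝ}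
  {W : ℕ → Ω → ℝ≥0} {q l : ℝ}

lemma ae_clock_pos (hW : IsExponentialClock P Y W l) (x : ℝ) (n : ℕ) :
    ∀ᵐ ω ∂(P x), 0 < W n ω := by
  have := ae_clockLaw_pos l
  rw [← hW.map_eq x n] at this
  exact ae_of_ae_map (hW.measurable n).aemeasurable this

lemma kernelOp_one (hY : IsCadlagMarkovProcess P Y) (q : ℝ) (hl : 0 < l) (y : ℝ) :
    kernelOp (discountedKernel hY q l) (fun _ => 1) y =
      ∫⁻ t, ENNReal.ofReal (Real.exp (-q * t)) ∂(clockLaw l) := by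
  rw [kernelOp, lintegral_discountedKernel hY q hl measurable_const]
  simp

lemma lintegral_obsDiscount (hY : IsCadlagMarkovProcess P Y) (hW : IsExponentialClock P Y W l)
    (hq : 0 < q) (hl : 0 < l) (x : ℝ) (n : ℕ) :
    ∫⁻ ω, obsDiscount q W n ω ∂(P x) =
      (∫⁻ t, ENNReal.ofReal (Real.exp (-q * t)) ∂(clockLaw l)) ^ n := by
  have := hY.isProbabilityMeasure x
  have hch := isDiscountedChain_obs hY hW hq hl x
  induction n with
  | zero => simp [hch.discount_zero]
  | succ n ih =>
    have h := hch.step n Set.univ MeasurableSet.univ (fun _ => 1) measurable_const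
    simp only [Measure.restrict_univ, mul_one, kernelOp_one hY q hl] at h
    rw [h, lintegral_mul_const _ (hch.measurable_discount' n), ih, pow_succ]

lemma tsum_lintegral_obsDiscount_ne_top (hY : IsCadlagMarkovProcess P Y)
    (hW : IsExponentialClock P Y W l) (hq : 0 < q) (hl : 0 < l) (x : ℝ) :
    ∑' n, ∫⁻ ω, obsDiscount q W n ω ∂(P x) ≠ ∞ := by
  simp_rw [lintegral_obsDiscount hY hW hq hl]
  rw [ENNReal.tsum_geometric]
  exact ENNReal.inv_ne_top.2 (tsub_pos_iff_lt.2 (lintegral_discount_lt_one hq hl)).ne'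

/-- The discounts have geometric, hence summable, means. So almost surely D_n → 0, which forces T_n
→ ∞. -/
lemma ae_obsTime_unbounded (hY : IsCadlagMarkovProcess P Y)
    (hW : IsExponentialClock P Y W l) (hq : 0 < q) (hl : 0 < l) (x : ℝ) :
    ∀ᵐ ω ∂(P x), ∀ s : ℝ≥0, ∃ n, s < obsTime W n ω := by
  have hch := isDiscountedChain_obs hY hW hq hl x
  have hfin := tsum_lintegral_obsDiscount_ne_top hY hW hq hl x
  rw [← lintegral_tsum fun n => (hch.measurable_discount' n).aemeasurable] at hfin
  filter_upwards [ae_lt_top (Measurable.tsum fun n => hch.measurable_discount' n) hfin]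
    with ω hω s
  by_contra! h
  have h1 := ENNReal.tendsto_atTop_zero_of_tsum_ne_top hω.ne
  have h2 : ENNReal.ofReal (Real.exp (-q * s)) ≤ 0 := by
    refine ge_of_tendsto' h1 fun n => ENNReal.ofReal_le_ofReal (Real.exp_le_exp.2 ?_)
    have : (obsTime W n ω : ℝ) ≤ s := by exact_mod_cast h n
    nlinarith
  rw [nonpos_iff_eq_zero, ENNReal.ofReal_eq_zero] at h2
  exact absurd (Real.exp_pos _) h2.not_gt

/-- The integral of e^{-qr} over [T_n, T_{n+1}] is D_n times c(W_n) with c(t) = (1 - e^{-qt})/q, and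
W_n is independent of D_n and X_n. The hypothesis is thus this series times the constant E[c(W)]. -/
lemma tsum_lintegral_reward_ne_top (hY : IsCadlagMarkovProcess P Y)
    (hW : IsExponentialClock P Y W l) (hq : 0 < q) (hl : 0 < l) {R : ℝ → ℝ} (hR : Measurable R)
    (hint : HasFiniteDiscountedReward P Y W q R) (x : ℝ) :
    ∑' n, ∫⁻ ω, obsDiscount q W n ω * ENNReal.ofReal |R (obsState Y W n ω)| ∂(P x) ≠ ∞ := by
  have := isProbabilityMeasure_clockLaw hl
  have hch := isDiscountedChain_obs hY hW hq hl x
  let c : ℝ≥0 → ℝ≥0∞ := fun t => ENNReal.ofReal ((1 - Real.exp (-q * t)) / q)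
  have hc : Measurable c := by fun_prop
  have hRabs : Measurable fun z => ENNReal.ofReal |R z| := by fun_prop
  have hint_eq (n : ℕ) (ω : Ω) : ENNReal.ofReal (|R (obsState Y W n ω)| *
      ∫ r in (obsTime W n ω : ℝ)..(obsTime W (n + 1) ω : ℝ), Real.exp (-q * r)) =
      obsDiscount q W n ω * ENNReal.ofReal |R (obsState Y W n ω)| * c (W n ω) := by
    have h1 : ∫ r in (obsTime W n ω : ℝ)..(obsTime W (n + 1) ω : ℝ), Real.exp (-q * r) =
        Real.exp (-q * obsTime W n ω) * ((1 - Real.exp (-q * W n ω)) / q) := by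
      rw [intervalIntegral.integral_comp_mul_left _ (neg_ne_zero.2 hq.ne'), integral_exp,
        obsTime_succ]
      push_cast
      rw [mul_add, Real.exp_add, smul_eq_mul]
      field_simp
      ring
    have h2 : 0 ≤ (1 - Real.exp (-q * W n ω)) / q := by
      refine div_nonneg (sub_nonneg.2 (Real.exp_le_one_iff.2 ?_)) hq.le
      have : 0 ≤ q * W n ω := by positivity
      linarith
    rw [h1, ENNReal.ofReal_mul (abs_nonneg _), ENNReal.ofReal_mul (Real.exp_nonneg _), obsDiscount]
    ring
  have hle := rawObsInfo_le_clockInfo (W := W) hY.cadlag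
  have hpeel (n : ℕ) : ∫⁻ ω, obsDiscount q W n ω * ENNReal.ofReal |R (obsState Y W n ω)| *
      c (W n ω) ∂(P x) = (∫⁻ ω, obsDiscount q W n ω * ENNReal.ofReal |R (obsState Y W n ω)| ∂(P x))
        * ∫⁻ t, c t ∂(clockLaw l) := by
    have hm : Measurable[clockInfo Y W n]
        fun ω => obsDiscount q W n ω * ENNReal.ofReal |R (obsState Y W n ω)| :=
      ((hch.measurable_discount n).mono (hle n) le_rfl).mul
        (hRabs.comp ((hch.measurable_state n).mono (hle n) le_rfl))
    have hF : Measurable[(clockInfo Y W n).prod inferInstance] fun p : Ω × ℝ≥0 =>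
        obsDiscount q W n p.1 * ENNReal.ofReal |R (obsState Y W n p.1)| * c p.2 :=
      (hm.comp (@measurable_fst Ω ℝ≥0 (clockInfo Y W n) _)).mul
        (hc.comp (@measurable_snd Ω ℝ≥0 (clockInfo Y W n) _))
    refine (lintegral_comp_clock hY hW x n hF).trans ?_
    simp_rw [lintegral_const_mul _ hc]
    rw [lintegral_mul_const _ (hch.measurable_mul hRabs n)]
  -- A nonzero mean of c allows finiteness to pass from the product to the series.
  have hc0 : ∫⁻ t, c t ∂(clockLaw l) ≠ 0 := by
    rw [Ne, lintegral_eq_zero_iff hc]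
    intro h0
    obtain ⟨t, ht, ht0⟩ := (h0.and (ae_clockLaw_pos l)).exists
    have h3 : (1 - Real.exp (-q * t)) / q ≤ 0 := ENNReal.ofReal_eq_zero.1 ht
    have h4 : 0 < (1 - Real.exp (-q * t)) / q := by
      refine div_pos (sub_pos.2 (Real.exp_lt_one_iff.2 ?_)) hq
      have : 0 < q * t := by positivity
      linarith
    exact absurd h3 h4.not_ge
  have h := (hint x).ne
  simp_rw [hint_eq] at h
  have hmeas (n : ℕ) : Measurable fun ω => obsDiscount q W n ω *
      ENNReal.ofReal |R (obsState Y W n ω)| * c (W n ω) :=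
    (hch.measurable_mul hRabs n).mul (hc.comp (hW.measurable n))
  rw [lintegral_tsum fun n => (hmeas n).aemeasurable] at h
  simp_rw [hpeel] at h
  rw [ENNReal.tsum_mul_right] at h
  exact fun htop => h (by rw [htop, ENNReal.top_mul hc0])

/-- Given the path and the first n durations, `φ` is a function of time alone, and W_n is a fresh
exponential variable to which `lintegral_clockLaw_setLIntegral` applies. -/
lemma lintegral_indicator_clock (hY : IsCadlagMarkovProcess P Y)
    (hW : IsExponentialClock P Y W l) (hl : 0 < l) (x : ℝ) (n : ℕ) {A : Set Ω}
    (hA : MeasurableSet[clockInfo Y W n] A) {φ : Ω × ℝ≥0 → ℝ≥0∞}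
    (hφ : Measurable[(clockInfo Y W n).prod inferInstance] φ) :
    ENNReal.ofReal l * ∫⁻ ω, A.indicator
        (fun ω => ∫⁻ u in Set.Ioo (0 : ℝ) (W n ω), φ (ω, u.toNNReal)) ω ∂(P x) =
      ∫⁻ ω in A, φ (ω, W n ω) ∂(P x) := by
  have hle : (clockInfo Y W n).prod inferInstance ≤
      (Prod.instMeasurableSpace : MeasurableSpace (Ω × ℝ≥0)) :=
    sup_le_sup (MeasurableSpace.comap_mono (clockInfo_le hY hW n)) le_rfl
  have hpre : MeasurableSet[(clockInfo Y W n).prod inferInstance]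
      (Prod.fst ⁻¹' A : Set (Ω × ℝ≥0)) := (@measurable_fst Ω ℝ≥0 (clockInfo Y W n) _) hA
  have hG := @measurable_setLIntegral_Ioo Ω (clockInfo Y W n) φ hφ
  have h1 := lintegral_comp_clock hY hW x n (hG.indicator hpre)
  have h2 := lintegral_comp_clock hY hW x n (hφ.indicator hpre)
  rw [← lintegral_indicator (clockInfo_le hY hW n _ hA)]
  refine (congrArg _ h1).trans (Eq.trans ?_ h2.symm)
  rw [← lintegral_const_mul' _ _ ENNReal.ofReal_ne_top]
  refine lintegral_congr fun ω => ?_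
  by_cases hω : ω ∈ A
  · have hmem (t : ℝ≥0) : (ω, t) ∈ (Prod.fst ⁻¹' A : Set (Ω × ℝ≥0)) := hω
    simp only [Set.indicator_of_mem (hmem _)]
    exact lintegral_clockLaw_setLIntegral hl ((hφ.mono hle le_rfl).comp measurable_prodMk_left)
  · have hmem (t : ℝ≥0) : (ω, t) ∉ (Prod.fst ⁻¹' A : Set (Ω × ℝ≥0)) := hω
    simp only [Set.indicator_of_notMem (hmem _)]
    simp

/-- The excursion integral of a nonnegative function is a sum over the observation times. -/
lemma lintegral_excursion (hY : IsCadlagMarkovProcess P Y) (hW : IsExponentialClock P Y W l)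
    (hq : 0 < q) (hl : 0 < l) (x : ℝ) {f : ℝ → ℝ≥0∞} (hf : Measurable f) :
    ENNReal.ofReal l * ∫⁻ ω, (∫⁻ s in timesBefore Y W x ω, ENNReal.ofReal (Real.exp (-q * s)) *
        (Set.Ioi x).indicator f (Y s.toNNReal ω)) ∂(P x) =
      ∑' n : ℕ, ∫⁻ ω in {ω | ((n + 1 : ℕ) : ℕ∞) < firstStepBelow (obsState Y W) x ω},
        obsDiscount q W (n + 1) ω * f (obsState Y W (n + 1) ω) ∂(P x) := by
  have hch := isDiscountedChain_obs hY hW hq hl x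
  have hg : Measurable ((Set.Ioi x).indicator f) := hf.indicator measurableSet_Ioi
  let φ : Ω → ℝ≥0 → ℝ≥0∞ := fun ω t => ENNReal.ofReal (Real.exp (-q * t)) *
    (Set.Ioi x).indicator f (Y t ω)
  let A : ℕ → Set Ω := fun n => {ω | (n : ℕ∞) < firstStepBelow (obsState Y W) x ω}
  have hA (n : ℕ) : MeasurableSet[rawObsInfo Y W n] (A n) := hch.measurableSet_lt_firstStepBelow n
  have hAm (n : ℕ) : MeasurableSet (A n) := hch.le n _ (hA n)
  have h1 : ∫⁻ ω, (∫⁻ s in timesBefore Y W x ω, ENNReal.ofReal (Real.exp (-q * s)) *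
      (Set.Ioi x).indicator f (Y s.toNNReal ω)) ∂(P x) = ∫⁻ ω, ∑' n, (A n).indicator
        (fun ω => ∫⁻ u in Set.Ioo (0 : ℝ) (W n ω), φ ω (obsTime W n ω + u.toNNReal)) ω ∂(P x) := by
    refine lintegral_congr_ae ?_
    filter_upwards [ae_clock_pos hW x 0, ae_obsTime_unbounded hY hW hq hl x] with ω h0 hinf
    refine Eq.trans ?_ (setLIntegral_timesBefore h0 hinf (φ ω))
    have hsub : MeasurableSet (timesBefore Y W x ω) :=
      measurableSet_Ioi.inter (measurableSet_lt ENNReal.measurable_ofReal measurable_const)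
    refine setLIntegral_congr_fun hsub fun s hs => ?_
    simp only [φ, Real.coe_toNNReal s hs.1.le]
  have h2 (n : ℕ) : ENNReal.ofReal l * ∫⁻ ω, (A n).indicator
      (fun ω => ∫⁻ u in Set.Ioo (0 : ℝ) (W n ω), φ ω (obsTime W n ω + u.toNNReal)) ω ∂(P x) =
      ∫⁻ ω in A (n + 1), obsDiscount q W (n + 1) ω * f (obsState Y W (n + 1) ω) ∂(P x) := by
    have hle := rawObsInfo_le_clockInfo (W := W) hY.cadlag n
    have hφ := @measurable_discounted_shift Ω (clockInfo Y W n) Y hY.cadlag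
      (fun t => (measurable_pathInfo Y t).mono le_sup_left le_rfl) (obsTime W n)
      ((measurable_obsTime_raw Y W n).mono hle le_rfl) q _ hg
    refine (lintegral_indicator_clock hY hW hl x n (hle _ (hA n)) hφ).trans ?_
    rw [← lintegral_indicator (hAm n), ← lintegral_indicator (hAm (n + 1))]
    refine lintegral_congr fun ω => ?_
    -- Within A n, the factor 1_{Y(T_{n+1}) > x} is exactly the condition for A (n + 1).
    by_cases hω : ω ∈ A (n + 1)
    · have hω' : ω ∈ A n := lt_firstStepBelow_iff.2 fun k hk hkn =>
        lt_firstStepBelow_iff.1 hω k hk (hkn.trans n.le_succ)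
      have hx : obsState Y W (n + 1) ω ∈ Set.Ioi x :=
        lt_firstStepBelow_iff.1 hω (n + 1) n.succ_pos le_rfl
      rw [Set.indicator_of_mem hω, Set.indicator_of_mem hω']
      simp only [← obsTime_succ]
      rw [Set.indicator_of_mem (by exact hx)]
      rfl
    · rw [Set.indicator_of_notMem hω]
      by_cases hω' : ω ∈ A n
      · have hx : obsState Y W (n + 1) ω ∉ Set.Ioi x := fun hx =>
          hω (lt_firstStepBelow_iff.2 fun k hk hkn => by
            rcases Nat.lt_or_ge n k with hnk | hnk
            · obtain rfl : k = n + 1 := by omega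
              exact hx
            · exact lt_firstStepBelow_iff.1 hω' k hk hnk)
        rw [Set.indicator_of_mem hω']
        simp only [← obsTime_succ]
        rw [Set.indicator_of_notMem (by exact hx), mul_zero]
      · rw [Set.indicator_of_notMem hω']
  rw [h1, lintegral_tsum, ← ENNReal.tsum_mul_left]
  · exact tsum_congr h2
  · intro n
    have hφ := measurable_discounted_shift hY.cadlag hY.measurable
      ((measurable_obsTime_raw Y W n).mono (hch.le n) le_rfl) q hg
    have hm : Measurable fun ω => ∫⁻ u in Set.Ioo (0 : ℝ) (W n ω),
        φ ω (obsTime W n ω + u.toNNReal) :=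
      (measurable_setLIntegral_Ioo hφ).comp (measurable_id.prodMk (hW.measurable n))
    exact (hm.indicator (hAm n)).aemeasurable

end Excursion

/-! ### From [0, ∞]-valued sums to real expectations, and optimality of the first return -/

section Index

variable {Ω : Type u}

lemma ofReal_excursionIntegrand (q : ℝ) (f : ℝ → ℝ) (Y : ℝ≥0 → Ω → ℝ) (x : ℝ) (ω : Ω) (s : ℝ) :
    ENNReal.ofReal (excursionIntegrand q f Y x ω s) = ENNReal.ofReal (Real.exp (-q * s)) *
      (Set.Ioi x).indicator (fun z => ENNReal.ofReal (f z)) (Y s.toNNReal ω) := by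
  unfold excursionIntegrand
  by_cases h : x < Y s.toNNReal ω
  · rw [if_pos h, mul_one, ENNReal.ofReal_mul (Real.exp_nonneg _), Set.indicator_of_mem (by exact h)]
  · rw [if_neg h, Set.indicator_of_notMem (by exact h)]
    simp

/-- The excursion integrand, cut off at `T_x^-`, jointly in path and time. -/
def cutExcursion (q : ℝ) (f : ℝ → ℝ) (Y : ℝ≥0 → Ω → ℝ) (W : ℕ → Ω → ℝ≥0) (x : ℝ) (p : Ω × ℝ) : ℝ :=
  (timesBefore Y W x p.1).indicator (excursionIntegrand q f Y x p.1) p.2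

lemma measurableSet_timesBefore (Y : ℝ≥0 → Ω → ℝ) (W : ℕ → Ω → ℝ≥0) (x : ℝ) (ω : Ω) :
    MeasurableSet (timesBefore Y W x ω) :=
  measurableSet_Ioi.inter (measurableSet_lt ENNReal.measurable_ofReal measurable_const)

lemma neg_cutExcursion (q : ℝ) (f : ℝ → ℝ) (Y : ℝ≥0 → Ω → ℝ) (W : ℕ → Ω → ℝ≥0) (x : ℝ)
    (p : Ω × ℝ) : -cutExcursion q f Y W x p = cutExcursion q (fun z => -f z) Y W x p := by
  unfold cutExcursion
  by_cases hs : p.2 ∈ timesBefore Y W x p.1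
  · rw [Set.indicator_of_mem hs, Set.indicator_of_mem hs]
    unfold excursionIntegrand
    ring
  · rw [Set.indicator_of_notMem hs, Set.indicator_of_notMem hs, neg_zero]

lemma enorm_cutExcursion (q : ℝ) (f : ℝ → ℝ) (Y : ℝ≥0 → Ω → ℝ) (W : ℕ → Ω → ℝ≥0) (x : ℝ)
    (p : Ω × ℝ) :
    ‖cutExcursion q f Y W x p‖ₑ = ENNReal.ofReal (cutExcursion q (fun z => |f z|) Y W x p) := by
  rw [← ofReal_norm, Real.norm_eq_abs]
  congr 1
  unfold cutExcursion
  by_cases hs : p.2 ∈ timesBefore Y W x p.1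
  · rw [Set.indicator_of_mem hs, Set.indicator_of_mem hs]
    unfold excursionIntegrand
    rw [abs_mul, abs_mul, Real.abs_exp, abs_of_nonneg (a := ite _ _ _)]
    split_ifs <;> norm_num
  · rw [Set.indicator_of_notMem hs, Set.indicator_of_notMem hs, abs_zero]

lemma excursionIntegral_eq (q : ℝ) (f : ℝ → ℝ) (Y : ℝ≥0 → Ω → ℝ) (W : ℕ → Ω → ℝ≥0) (x : ℝ)
    (ω : Ω) : excursionIntegral q f Y W x ω = ∫ s, cutExcursion q f Y W x (ω, s) :=
  (integral_indicator (measurableSet_timesBefore Y W x ω)).symm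

variable [mΩ : MeasurableSpace Ω] {P : ℝ → Measure Ω} {Y : ℝ≥0 → Ω → ℝ}
  {W : ℕ → Ω → ℝ≥0} {q l : ℝ}

lemma measurable_firstObsBelow (hY : IsCadlagMarkovProcess P Y) (hW : IsExponentialClock P Y W l)
    (x : ℝ) : Measurable (firstObsBelow Y W x) := by
  have hT (n : ℕ) : Measurable (obsTime W n) := measurable_obsTime_of fun i _ => hW.measurable i
  have hX (n : ℕ) : Measurable (obsState Y W n) :=
    measurable_obsState_of hY.cadlag hY.measurable fun i _ => hW.measurable i
  have heq : firstObsBelow Y W x = fun ω => ⨅ n : ℕ,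
      ({ω | 0 < obsTime W n ω} ∩ {ω | obsState Y W n ω ≤ x}).piecewise
        (fun ω => (obsTime W n ω : ℝ≥0∞)) (fun _ => ∞) ω := by
    classical
    ext ω
    refine le_antisymm (le_iInf fun n => ?_) (le_sInf ?_)
    · by_cases h : ω ∈ {ω | 0 < obsTime W n ω} ∩ {ω | obsState Y W n ω ≤ x}
      · rw [Set.piecewise_eq_of_mem _ _ _ h]
        exact sInf_le ⟨n, rfl, ENNReal.coe_pos.2 h.1, h.2⟩
      · rw [Set.piecewise_eq_of_notMem _ _ _ h]
        exact le_top
    · rintro _ ⟨n, rfl, h0, hx⟩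
      refine (iInf_le _ n).trans ?_
      have hmem : ω ∈ {ω | 0 < obsTime W n ω} ∩ {ω | obsState Y W n ω ≤ x} :=
        ⟨ENNReal.coe_pos.1 h0, hx⟩
      rw [Set.piecewise_eq_of_mem _ _ _ hmem]
  rw [heq]
  refine Measurable.iInf fun n => ?_
  exact Measurable.piecewise ((measurableSet_lt measurable_const (hT n)).inter
    (measurableSet_le (hX n) measurable_const)) (hT n).coe_nnreal_ennreal measurable_const

lemma measurable_cutExcursion (hY : IsCadlagMarkovProcess P Y) (hW : IsExponentialClock P Y W l)
    {f : ℝ → ℝ} (hf : Measurable f) (x : ℝ) : Measurable (cutExcursion q f Y W x) := by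
  have hset : MeasurableSet {p : Ω × ℝ | p.2 ∈ timesBefore Y W x p.1} :=
    (measurableSet_lt measurable_const measurable_snd).inter
      (measurableSet_lt (ENNReal.measurable_ofReal.comp measurable_snd)
        ((measurable_firstObsBelow hY hW x).comp measurable_fst))
  have hYs : Measurable fun p : Ω × ℝ => Y p.2.toNNReal p.1 :=
    (measurable_uncurry_of_rightContinuous hY.measurable fun ω => (hY.cadlag ω).1).comp
      (measurable_fst.prodMk (measurable_real_toNNReal.comp measurable_snd))
  have hexc : Measurable fun p : Ω × ℝ => excursionIntegrand q f Y x p.1 p.2 := by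
    refine (Measurable.mul ?_ (hf.comp hYs)).mul
      (Measurable.ite (measurableSet_lt measurable_const hYs) measurable_const measurable_const)
    fun_prop
  exact hexc.indicator hset

/-- The expected discounted rewards collected at the steps `n` on the events `A n`, in `[0, ∞]`. -/
def stoppedSum (μ : Measure Ω) (q : ℝ) (Y : ℝ≥0 → Ω → ℝ) (W : ℕ → Ω → ℝ≥0) (f : ℝ → ℝ≥0∞)
    (A : ℕ → Set Ω) : ℝ≥0∞ :=
  ∑' n : ℕ, ∫⁻ ω in A n, obsDiscount q W n ω * f (obsState Y W n ω) ∂μ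

lemma stoppedSum_le (μ : Measure Ω) (q : ℝ) (Y : ℝ≥0 → Ω → ℝ) (W : ℕ → Ω → ℝ≥0)
    {f g : ℝ → ℝ≥0∞} (hfg : f ≤ g) (A : ℕ → Set Ω) :
    stoppedSum μ q Y W f A ≤ ∑' n, ∫⁻ ω, obsDiscount q W n ω * g (obsState Y W n ω) ∂μ :=
  ENNReal.tsum_le_tsum fun _ => (setLIntegral_le_lintegral _ _).trans
    (lintegral_mono fun _ => mul_le_mul_right (hfg _) _)

lemma lintegral_ofReal_cutExcursion (hY : IsCadlagMarkovProcess P Y)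
    (hW : IsExponentialClock P Y W l) (hq : 0 < q) (hl : 0 < l) (x : ℝ) {f : ℝ → ℝ}
    (hf : Measurable f) :
    ENNReal.ofReal l * ∫⁻ p, ENNReal.ofReal (cutExcursion q f Y W x p) ∂((P x).prod volume) =
      ∑' n : ℕ, ∫⁻ ω in {ω | ((n + 1 : ℕ) : ℕ∞) < firstStepBelow (obsState Y W) x ω},
        obsDiscount q W (n + 1) ω * ENNReal.ofReal (f (obsState Y W (n + 1) ω)) ∂(P x) := by
  have := hY.isProbabilityMeasure x
  rw [← lintegral_excursion hY hW hq hl x (f := fun z => ENNReal.ofReal (f z)) (by fun_prop),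
    lintegral_prod _ (measurable_cutExcursion hY hW hf x).ennreal_ofReal.aemeasurable]
  congr 1
  refine lintegral_congr fun ω => ?_
  rw [← lintegral_indicator (measurableSet_timesBefore Y W x ω)]
  refine lintegral_congr fun s => ?_
  unfold cutExcursion
  by_cases hs : s ∈ timesBefore Y W x ω
  · rw [Set.indicator_of_mem (by exact hs), Set.indicator_of_mem hs, ofReal_excursionIntegrand]
  · rw [Set.indicator_of_notMem (by exact hs), Set.indicator_of_notMem hs, ENNReal.ofReal_zero]

/-- Integrability of the discounted rewards of the observed chain. -/
def HasSummableReward (μ : Measure Ω) (q : ℝ) (Y : ℝ≥0 → Ω → ℝ) (W : ℕ → Ω → ℝ≥0)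
    (f : ℝ → ℝ) : Prop :=
  ∑' n, ∫⁻ ω, obsDiscount q W n ω * ENNReal.ofReal |f (obsState Y W n ω)| ∂μ ≠ ∞

lemma HasSummableReward.stoppedSum_ne_top {μ : Measure Ω} {f : ℝ → ℝ}
    (h : HasSummableReward μ q Y W f) {g : ℝ → ℝ} (hg : ∀ z, g z ≤ |f z|) (A : ℕ → Set Ω) :
    stoppedSum μ q Y W (fun z => ENNReal.ofReal (g z)) A ≠ ∞ :=
  ne_top_of_le_ne_top h (stoppedSum_le μ q Y W (fun z => ENNReal.ofReal_le_ofReal (hg z)) A)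

/-- By Tonelli, l times the mass of |f| over excursions is a sum over steps n ≥ 1, bounded by the
summable rewards; l > 0 is then divided out. -/
lemma integrable_cutExcursion (hY : IsCadlagMarkovProcess P Y) (hW : IsExponentialClock P Y W l)
    (hq : 0 < q) (hl : 0 < l) (x : ℝ) {f : ℝ → ℝ} (hf : Measurable f)
    (hfs : HasSummableReward (P x) q Y W f) :
    Integrable (cutExcursion q f Y W x) ((P x).prod volume) := by
  refine ⟨(measurable_cutExcursion hY hW hf x).aestronglyMeasurable, ?_⟩
  rw [HasFiniteIntegral]
  simp_rw [enorm_cutExcursion]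
  have h := lintegral_ofReal_cutExcursion hY hW hq hl x (f := fun z => |f z|) (by fun_prop)
  have hne : ∑' n : ℕ, ∫⁻ ω in {ω | ((n + 1 : ℕ) : ℕ∞) < firstStepBelow (obsState Y W) x ω},
        obsDiscount q W (n + 1) ω * ENNReal.ofReal |f (obsState Y W (n + 1) ω)| ∂(P x) ≠ ∞ := by
    refine ne_top_of_le_ne_top hfs ?_
    rw [tsum_eq_zero_add' (f := fun n => ∫⁻ ω, obsDiscount q W n ω *
      ENNReal.ofReal |f (obsState Y W n ω)| ∂(P x)) ENNReal.summable]
    refine le_add_left (ENNReal.tsum_le_tsum fun n => setLIntegral_le_lintegral _ _)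
  rw [← h] at hne
  refine lt_top_iff_ne_top.2 fun htop => hne ?_
  rw [htop, ENNReal.mul_top (by simpa using hl)]

/-- Joint integrability in (ω, s) gives both claims at once by Fubini. -/
lemma hasIntegrableExcursion (hY : IsCadlagMarkovProcess P Y) (hW : IsExponentialClock P Y W l)
    (hq : 0 < q) (hl : 0 < l) (x : ℝ) {f : ℝ → ℝ} (hf : Measurable f)
    (hfs : HasSummableReward (P x) q Y W f) : HasIntegrableExcursion (P x) q f Y W x := by
  have := hY.isProbabilityMeasure x
  have hi := integrable_cutExcursion hY hW hq hl x hf hfs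
  constructor
  · filter_upwards [hi.prod_right_ae] with ω hω
    exact (integrable_indicator_iff (measurableSet_timesBefore Y W x ω)).1 hω
  · exact hi.integral_prod_left.congr
      (Eventually.of_forall fun ω => (excursionIntegral_eq q f Y W x ω).symm)

/-- The real-valued expected reward up to a stopping rule. -/
lemma integral_discountedSum (hY : IsCadlagMarkovProcess P Y) (hW : IsExponentialClock P Y W l)
    (hq : 0 < q) (hl : 0 < l) (x : ℝ) {f : ℝ → ℝ} (hf : Measurable f)
    (hfs : HasSummableReward (P x) q Y W f) {τ : Ω → ℕ∞}
    (hτ : ∀ n : ℕ, NullMeasurableSet {ω | (n : ℕ∞) < τ ω} (P x)) :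
    HasSum (fun n : ℕ => ∫ ω in {ω | (n : ℕ∞) < τ ω},
      Real.exp (-q * obsTime W n ω) * f (obsState Y W n ω) ∂(P x))
      (∫ ω, discountedSum q f Y W τ ω ∂(P x)) ∧
    (∀ n : ℕ, Integrable (fun ω => Real.exp (-q * obsTime W n ω) * f (obsState Y W n ω)) (P x)) ∧
    ∫ ω, discountedSum q f Y W τ ω ∂(P x) =
      (stoppedSum (P x) q Y W (fun z => ENNReal.ofReal (f z))
        fun n => {ω | (n : ℕ∞) < τ ω}).toReal -
      (stoppedSum (P x) q Y W (fun z => ENNReal.ofReal (-f z))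
        fun n => {ω | (n : ℕ∞) < τ ω}).toReal := by
  have := hY.isProbabilityMeasure x
  have hch := isDiscountedChain_obs hY hW hq hl x
  let v : ℕ → Ω → ℝ := fun n ω => Real.exp (-q * obsTime W n ω) * f (obsState Y W n ω)
  have hT (n : ℕ) : Measurable (obsTime W n) := measurable_obsTime_of fun i _ => hW.measurable i
  have hvm (n : ℕ) : Measurable (v n) := by
    refine Measurable.mul ?_ (hf.comp (hch.measurable_state' n))
    have := hT n
    fun_prop
  have hve (n : ℕ) (ω : Ω) : ‖v n ω‖ₑ =
      obsDiscount q W n ω * ENNReal.ofReal |f (obsState Y W n ω)| := by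
    rw [← ofReal_norm, Real.norm_eq_abs, abs_mul, Real.abs_exp,
      ENNReal.ofReal_mul (Real.exp_nonneg _), obsDiscount]
  have hvi (n : ℕ) : Integrable (v n) (P x) := by
    refine ⟨(hvm n).aestronglyMeasurable, ?_⟩
    rw [HasFiniteIntegral]
    simp_rw [hve]
    exact lt_top_iff_ne_top.2 (ENNReal.ne_top_of_tsum_ne_top hfs n)
  let A : ℕ → Set Ω := fun n => {ω | (n : ℕ∞) < τ ω}
  have hds (ω : Ω) : discountedSum q f Y W τ ω = ∑' n, (A n).indicator (v n) ω := by
    refine tsum_congr fun n => ?_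
    by_cases h : (n : ℕ∞) < τ ω
    · rw [if_pos h, Set.indicator_of_mem (by exact h)]
    · rw [if_neg h, Set.indicator_of_notMem (by exact h)]
  have hint (n : ℕ) : Integrable ((A n).indicator (v n)) (P x) := (hvi n).indicator₀ (hτ n)
  have hbound (n : ℕ) : ∫⁻ ω, ‖(A n).indicator (v n) ω‖ₑ ∂(P x) ≤
      ∫⁻ ω, obsDiscount q W n ω * ENNReal.ofReal |f (obsState Y W n ω)| ∂(P x) := by
    refine lintegral_mono fun ω => ?_
    rw [← hve]
    exact enorm_indicator_le_enorm_self _ _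
  have hsummable : Summable fun n => ∫ ω, ‖(A n).indicator (v n) ω‖ ∂(P x) := by
    have h1 : ∑' n, ∫⁻ ω, ‖(A n).indicator (v n) ω‖ₑ ∂(P x) ≠ ∞ :=
      ne_top_of_le_ne_top hfs (ENNReal.tsum_le_tsum hbound)
    refine (ENNReal.summable_toReal h1).congr fun n => ?_
    rw [integral_norm_eq_lintegral_enorm (hint n).aestronglyMeasurable]
  have hsum := hasSum_integral_of_summable_integral_norm hint hsummable
  have hind (n : ℕ) : ∫ ω, (A n).indicator (v n) ω ∂(P x) = ∫ ω in A n, v n ω ∂(P x) :=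
    integral_indicator₀ (hτ n)
  simp_rw [hind, ← hds] at hsum
  refine ⟨hsum, hvi, ?_⟩
  -- Positive and negative parts are separated to meet the [0, ∞]-valued gain and loss of the
  -- stopping problem.
  have hparts (n : ℕ) : ∫ ω in A n, v n ω ∂(P x) =
      (∫⁻ ω in A n, obsDiscount q W n ω * ENNReal.ofReal (f (obsState Y W n ω)) ∂(P x)).toReal -
      (∫⁻ ω in A n, obsDiscount q W n ω * ENNReal.ofReal (-f (obsState Y W n ω)) ∂(P x)).toReal := by
    rw [integral_eq_lintegral_pos_part_sub_lintegral_neg_part (hvi n).restrict]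
    congr 3 <;> ext ω
    · simp only [v, ENNReal.ofReal_mul (Real.exp_nonneg _), obsDiscount]
    · simp only [v, ← mul_neg, ENNReal.ofReal_mul (Real.exp_nonneg _), obsDiscount]
  have hp := hfs.stoppedSum_ne_top (fun z => le_abs_self (f z)) A
  have hm := hfs.stoppedSum_ne_top (fun z => neg_le_abs (f z)) A
  rw [← hsum.tsum_eq, tsum_congr hparts, Summable.tsum_sub (ENNReal.summable_toReal hp)
    (ENNReal.summable_toReal hm), stoppedSum, stoppedSum,
    ENNReal.tsum_toReal_eq (ENNReal.ne_top_of_tsum_ne_top hp),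
    ENNReal.tsum_toReal_eq (ENNReal.ne_top_of_tsum_ne_top hm)]

/-- Step 0 always counts and contributes f(x); the later steps before the first return are l times
the excursion integral. Both identities hold in [0, ∞], so they are applied to the positive and
negative parts of f. -/
lemma integral_discountedSum_firstStepBelow (hY : IsCadlagMarkovProcess P Y)
    (hW : IsExponentialClock P Y W l) (hq : 0 < q) (hl : 0 < l) (x : ℝ) {f : ℝ → ℝ}
    (hf : Measurable f) (hfs : HasSummableReward (P x) q Y W f) :
    ∫ ω, discountedSum q f Y W (firstStepBelow (obsState Y W) x) ω ∂(P x) =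
      f x + l * ∫ ω, excursionIntegral q f Y W x ω ∂(P x) := by
  have := hY.isProbabilityMeasure x
  have hch := isDiscountedChain_obs hY hW hq hl x
  have hA (n : ℕ) : MeasurableSet {ω | (n : ℕ∞) < firstStepBelow (obsState Y W) x ω} :=
    hch.le n _ (hch.measurableSet_lt_firstStepBelow n)
  have hi := integrable_cutExcursion hY hW hq hl x hf hfs
  have hexc : ∫ ω, excursionIntegral q f Y W x ω ∂(P x) =
      ∫ p, cutExcursion q f Y W x p ∂((P x).prod volume) := by
    simp_rw [excursionIntegral_eq]
    exact (integral_prod _ hi).symm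
  have hsplit (g : ℝ → ℝ) (hg : Measurable g) (hgf : ∀ z, g z ≤ |f z|) :
      (stoppedSum (P x) q Y W (fun z => ENNReal.ofReal (g z))
        fun n => {ω | (n : ℕ∞) < firstStepBelow (obsState Y W) x ω}).toReal =
      (ENNReal.ofReal (g x)).toReal + l *
        (∫⁻ p, ENNReal.ofReal (cutExcursion q g Y W x p) ∂((P x).prod volume)).toReal := by
    have hne := hfs.stoppedSum_ne_top hgf
      fun n => {ω | (n : ℕ∞) < firstStepBelow (obsState Y W) x ω}
    rw [stoppedSum, tsum_eq_zero_add' ENNReal.summable,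
      ← lintegral_ofReal_cutExcursion hY hW hq hl x hg] at hne
    have huniv : {ω | ((0 : ℕ) : ℕ∞) < firstStepBelow (obsState Y W) x ω} = Set.univ :=
      Set.eq_univ_of_forall fun ω => firstStepBelow_pos _ _ _
    rw [stoppedSum, tsum_eq_zero_add' ENNReal.summable,
      ← lintegral_ofReal_cutExcursion hY hW hq hl x hg,
      ENNReal.toReal_add (fun h => hne (by rw [h, top_add])) (fun h => hne (by rw [h, add_top])),
      ENNReal.toReal_mul, ENNReal.toReal_ofReal hl.le, huniv, Measure.restrict_univ,
      hch.lintegral_start fun z => ENNReal.ofReal (g z)]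
  rw [(integral_discountedSum hY hW hq hl x hf hfs fun n => (hA n).nullMeasurableSet).2.2,
    hsplit f hf fun z => le_abs_self _, hsplit (fun z => -f z) hf.neg fun z => neg_le_abs _,
    hexc, integral_eq_lintegral_pos_part_sub_lintegral_neg_part hi]
  simp_rw [neg_cutExcursion]
  have hx : (ENNReal.ofReal (f x)).toReal - (ENNReal.ofReal (-f x)).toReal = f x := by
    rw [ENNReal.toReal_ofReal', ENNReal.toReal_ofReal']
    exact max_zero_sub_eq_self (f x)
  linarith

lemma isPositiveStoppingTime_firstStepBelow (hY : IsCadlagMarkovProcess P Y)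
    (hW : IsExponentialClock P Y W l) (hq : 0 < q) (hl : 0 < l) (x : ℝ) :
    IsPositiveStoppingTime (P x) Y W (firstStepBelow (obsState Y W) x) := by
  refine ⟨firstStepBelow_pos _ _, fun n => le_eventuallyMeasurableSpace _ ?_⟩
  have h := ((isDiscountedChain_obs hY hW hq hl x).measurableSet_lt_firstStepBelow n).compl
  convert h using 1
  ext ω
  simp

/-- A completed stopping time agrees almost surely with an uncompleted one, event by event. -/
lemma IsPositiveStoppingTime.exists_raw {μ : Measure Ω} {τ : Ω → ℕ∞}
    (hτ : IsPositiveStoppingTime μ Y W τ) (n : ℕ) :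
    ∃ A, MeasurableSet[rawObsInfo Y W n] A ∧ {ω | (n : ℕ∞) < τ ω} =ᵐ[μ] A := by
  obtain ⟨A, hA, h⟩ := hτ.2 n
  refine ⟨Aᶜ, hA.compl, ?_⟩
  have heq : {ω | (n : ℕ∞) < τ ω} = {ω | τ ω ≤ n}ᶜ := by ext ω; simp
  exact heq ▸ h.compl

/-- No stopping time beats the rule which stops at the first return to `(-∞, x]`. -/
lemma integral_discountedSum_le (hY : IsCadlagMarkovProcess P Y) (hW : IsExponentialClock P Y W l)
    (hord : IsOrderPreserving P Y) (hq : 0 < q) (hl : 0 < l) (x : ℝ) {g : ℝ → ℝ}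
    (hg : Monotone g) (hgs : HasSummableReward (P x) q Y W g)
    (hfair : ∫ ω, discountedSum q g Y W (firstStepBelow (obsState Y W) x) ω ∂(P x) = 0)
    {τ : Ω → ℕ∞} (hτ : IsPositiveStoppingTime (P x) Y W τ) :
    ∫ ω, discountedSum q g Y W τ ω ∂(P x) ≤ 0 := by
  have := hY.isProbabilityMeasure x
  have hch := isDiscountedChain_obs hY hW hq hl x
  have hK := monotone_kernelOp_discountedKernel hord hY q hl
  have hp : Monotone fun z => ENNReal.ofReal (g z) := fun _ _ h => ENNReal.ofReal_le_ofReal (hg h)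
  have hm : Antitone fun z => ENNReal.ofReal (-g z) := fun _ _ h =>
    ENNReal.ofReal_le_ofReal (neg_le_neg (hg h))
  have hA (n : ℕ) : MeasurableSet {ω | (n : ℕ∞) < firstStepBelow (obsState Y W) x ω} :=
    hch.le n _ (hch.measurableSet_lt_firstStepBelow n)
  have hpne (A : ℕ → Set Ω) := hgs.stoppedSum_ne_top (fun z => le_abs_self (g z)) A
  have hmne (A : ℕ → Set Ω) := hgs.stoppedSum_ne_top (fun z => neg_le_abs (g z)) A
  -- Finiteness turns the vanishing real expectation into equality of gain and loss in [0, ∞].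
  rw [(integral_discountedSum hY hW hq hl x hg.measurable hgs
    fun n => (hA n).nullMeasurableSet).2.2, sub_eq_zero,
    ENNReal.toReal_eq_toReal_iff' (hpne _) (hmne _)] at hfair
  have hpot : potential (discountedKernel hY q l) (fun z => ENNReal.ofReal (g z)) x ≠ ∞ := by
    rw [← hch.tsum_lintegral hp.measurable]
    exact ne_top_of_le_ne_top hgs (ENNReal.tsum_le_tsum fun n => lintegral_mono fun ω =>
      mul_le_mul_right (ENNReal.ofReal_le_ofReal (le_abs_self _)) _)
  have hD : ∫⁻ ω, obsDiscount q W 1 ω ∂(P x) < 1 := by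
    rw [lintegral_obsDiscount hY hW hq hl, pow_one]
    exact lintegral_discount_lt_one hq hl
  have hV := hch.stoppingValue_eq_zero hK hp hm hpot hD hfair
  choose A hAr hAe using hτ.exists_raw
  have hnull (n : ℕ) : NullMeasurableSet {ω | (n : ℕ∞) < τ ω} (P x) :=
    (hch.le n _ (hAr n)).nullMeasurableSet.congr (hAe n).symm
  -- The uncompleted events are chosen separately for each n, so they are nested only up to null
  -- sets.
  have hanti (n : ℕ) : A (n + 1) ≤ᵐ[P x] A n := by
    refine (hAe (n + 1)).symm.le.trans (EventuallyLE.trans ?_ (hAe n).le)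
    refine Eventually.of_forall fun ω hω => ?_
    exact lt_trans (by exact_mod_cast n.lt_succ_self) (show ((n + 1 : ℕ) : ℕ∞) < τ ω from hω)
  have hcongr (f : ℝ → ℝ≥0∞) : stoppedSum (P x) q Y W f (fun n => {ω | (n : ℕ∞) < τ ω}) =
      stoppedSum (P x) q Y W f A :=
    tsum_congr fun n => setLIntegral_congr (hAe n)
  have hver := hch.gain_le_value_add_loss hK hp hm hAr hanti
  rw [hV, zero_add] at hver
  rw [(integral_discountedSum hY hW hq hl x hg.measurable hgs hnull).2.2, sub_nonpos, hcongr, hcongr]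
  exact ENNReal.toReal_mono (hmne A) hver

/-- A positive stopping time always includes step 0, whose discount is 1. This keeps every
denominator of a ratio positive. -/
lemma one_le_integral_discountedSum_one (hY : IsCadlagMarkovProcess P Y)
    (hW : IsExponentialClock P Y W l) (hq : 0 < q) (hl : 0 < l) (x : ℝ)
    (hs : HasSummableReward (P x) q Y W fun _ => 1) {τ : Ω → ℕ∞}
    (hτ : ∀ n : ℕ, NullMeasurableSet {ω | (n : ℕ∞) < τ ω} (P x)) (hpos : ∀ ω, 0 < τ ω) :
    1 ≤ ∫ ω, discountedSum q (fun _ => 1) Y W τ ω ∂(P x) := by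
  have := hY.isProbabilityMeasure x
  have h := (integral_discountedSum hY hW hq hl x measurable_const hs hτ).1
  have h0 : ∫ ω in {ω | ((0 : ℕ) : ℕ∞) < τ ω}, Real.exp (-q * obsTime W 0 ω) * 1 ∂(P x) = 1 := by
    have huniv : {ω | ((0 : ℕ) : ℕ∞) < τ ω} = Set.univ := Set.eq_univ_of_forall fun ω => hpos ω
    rw [huniv, Measure.restrict_univ]
    simp [obsTime]
  have := le_hasSum h 0 fun n _ => integral_nonneg fun ω => by positivity
  rwa [h0] at this

end Index

end

theorem theorem4p1 {Ω : Type u} [MeasurableSpace Ω]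
    (P : ℝ → Measure Ω) (Y : ℝ≥0 → Ω → ℝ) (W : ℕ → Ω → ℝ≥0) (R : ℝ → ℝ) (q l : ℝ)
    (hq : 0 < q) (hl : 0 < l)
    (hY : IsCadlagMarkovProcess P Y)
    (hW : IsExponentialClock P Y W l)
    (hR : StrictMono R)
    (hord : IsOrderPreserving P Y)
    (hint : HasFiniteDiscountedReward P Y W q R)
    (x : ℝ) :
    IsLUB (gittinsRatios P Y W q R x) (gittinsIndex P Y W q R x) ∧
    HasIntegrableExcursion (P x) q R Y W x ∧
    HasIntegrableExcursion (P x) q (fun _ => 1) Y W x ∧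
    gittinsIndex P Y W q R x =
      (R x + l * ∫ ω, excursionIntegral q R Y W x ω ∂(P x)) /
      (1 + l * ∫ ω, excursionIntegral q (fun _ => 1) Y W x ω ∂(P x)) := by
  have := hY.isProbabilityMeasure x
  have hch := isDiscountedChain_obs hY hW hq hl x
  have hRm : Measurable R := hR.monotone.measurable
  have hRs : HasSummableReward (P x) q Y W R :=
    tsum_lintegral_reward_ne_top hY hW hq hl hRm hint x
  have h1s : HasSummableReward (P x) q Y W fun _ => 1 := by
    have := tsum_lintegral_obsDiscount_ne_top hY hW hq hl x
    simpa [HasSummableReward] using this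
  have hnull {τ : Ω → ℕ∞} (hτ : IsPositiveStoppingTime (P x) Y W τ) (n : ℕ) :
      NullMeasurableSet {ω | (n : ℕ∞) < τ ω} (P x) := by
    obtain ⟨A, hA, hAe⟩ := hτ.exists_raw n
    exact (hch.le n _ hA).nullMeasurableSet.congr hAe.symm
  have hτ₀ := isPositiveStoppingTime_firstStepBelow hY hW hq hl x
  set τ₀ := firstStepBelow (obsState Y W) x with hτ₀def
  -- Subtracting this ratio from the reward makes the first return to (-∞, x] a fair game.
  set γ := (∫ ω, discountedSum q R Y W τ₀ ω ∂(P x)) /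
    (∫ ω, discountedSum q (fun _ => 1) Y W τ₀ ω ∂(P x)) with hγ
  have hden {τ : Ω → ℕ∞} (hτ : IsPositiveStoppingTime (P x) Y W τ) :
      0 < ∫ ω, discountedSum q (fun _ => 1) Y W τ ω ∂(P x) :=
    zero_lt_one.trans_le
      (one_le_integral_discountedSum_one hY hW hq hl x h1s (hnull hτ) hτ.1)
  have hg : Monotone fun z => R z - γ := fun a b h => sub_le_sub_right (hR.monotone h) γ
  have hgs : HasSummableReward (P x) q Y W fun z => R z - γ := by
    have hb : ∑' n, ∫⁻ ω, obsDiscount q W n ω * ENNReal.ofReal |R (obsState Y W n ω)| ∂(P x) +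
        ENNReal.ofReal |γ| * ∑' n, ∫⁻ ω, obsDiscount q W n ω ∂(P x) ≠ ∞ :=
      ENNReal.add_ne_top.2 ⟨hRs, ENNReal.mul_ne_top ENNReal.ofReal_ne_top
        (tsum_lintegral_obsDiscount_ne_top hY hW hq hl x)⟩
    refine ne_top_of_le_ne_top hb ?_
    rw [← ENNReal.tsum_mul_left, ← ENNReal.tsum_add]
    refine ENNReal.tsum_le_tsum fun n => ?_
    rw [← lintegral_const_mul _ (hch.measurable_discount' n),
      ← lintegral_add_right _ ((hch.measurable_discount' n).const_mul _)]
    refine lintegral_mono fun ω => ?_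
    dsimp only
    rw [mul_comm (ENNReal.ofReal |γ|), ← mul_add, ← ENNReal.ofReal_add (abs_nonneg _) (abs_nonneg _)]
    exact mul_le_mul_right (ENNReal.ofReal_le_ofReal (abs_sub _ _)) _
  -- A ratio is at most γ exactly when the reward R - γ has nonpositive expectation; this linearity
  -- makes the translation.
  have hlin {τ : Ω → ℕ∞} (hτ : IsPositiveStoppingTime (P x) Y W τ) :
      ∫ ω, discountedSum q (fun z => R z - γ) Y W τ ω ∂(P x) =
      ∫ ω, discountedSum q R Y W τ ω ∂(P x) -
        γ * ∫ ω, discountedSum q (fun _ => 1) Y W τ ω ∂(P x) := by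
    obtain ⟨hs1, hi1, -⟩ := integral_discountedSum hY hW hq hl x hRm hRs (hnull hτ)
    obtain ⟨hs2, hi2, -⟩ := integral_discountedSum hY hW hq hl x measurable_const h1s (hnull hτ)
    have hs3 := (integral_discountedSum hY hW hq hl x hg.measurable hgs (hnull hτ)).1
    refine hs3.unique ((hs1.sub (hs2.mul_left γ)).congr_fun fun n => ?_)
    rw [← integral_const_mul, ← integral_sub (hi1 n).restrict ((hi2 n).restrict.const_mul γ)]
    refine integral_congr_ae (Eventually.of_forall fun ω => ?_)
    dsimp only
    ring
  have hfair : ∫ ω, discountedSum q (fun z => R z - γ) Y W τ₀ ω ∂(P x) = 0 := by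
    rw [hlin hτ₀, hγ, div_mul_cancel₀ _ (hden hτ₀).ne', sub_self]
  have hgreatest : IsGreatest (gittinsRatios P Y W q R x) γ := by
    refine ⟨⟨τ₀, hτ₀, rfl⟩, ?_⟩
    rintro v ⟨τ, hτ, rfl⟩
    have h := integral_discountedSum_le hY hW hord hq hl x hg hgs hfair hτ
    rw [hlin hτ] at h
    rw [div_le_iff₀ (hden hτ)]
    linarith
  -- The supremum is attained, so `sSup` is a genuine maximum and not a default value.
  have hindex : gittinsIndex P Y W q R x = γ := hgreatest.csSup_eq
  refine ⟨hindex ▸ hgreatest.isLUB, hasIntegrableExcursion hY hW hq hl x hRm hRs,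
    hasIntegrableExcursion hY hW hq hl x measurable_const h1s, ?_⟩
  rw [hindex, hγ, integral_discountedSum_firstStepBelow hY hW hq hl x hRm hRs,
    integral_discountedSum_firstStepBelow hY hW hq hl x measurable_const h1s]
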